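/- Let $\lambda\in\mathbb C$ with $\lambda\neq 0,-1$. Let $\mathfrak g=\mathfrak g(\mathbb Z,\lambda)$ be the deformed Heisenberg–Virasoro algebra, i.e. the complex Lie algebra with basis $\{L_n, I_n, C_L, C_{LI}^{(1)} \mid n\in\mathbb Z\}$ in which $C_L$ and $C_{LI}^{(1)}$ are central and, for $m,n\in\mathbb Z$, $$[L_m,L_n]=(n-m)L_{m+n}+\tfrac1{12}(m^3-m)\,\delta_{m+n,0}\,C_L,\qquad [I_m,I_n]=0,$$ $$[L_m,I_n]=(n-\lambda m)I_{m+n}+\tfrac1{12}(m^3-m)\,\delta_{\lambda,1}\,\delta_{m+n,0}\,C_{LI}^{(1)}.$$ Let $\mathfrak g_0=\operatorname{span}_{\mathbb C}\{L_0,I_0,C_L,C_{LI}^{(1)}\}$, let $\varphi:\mathfrak g_0\to\mathbb C$ be a linear function, and let $M(\varphi)=U(\mathfrak g)/I(\varphi)$ be the Verma module with highest weight $\varphi$, where $I(\varphi)$ is the left ideal of the universal enveloping algebra $U(\mathfrak g)$ generated by $\{L_n,I_n\mid n>0\}\cup\{x-\varphi(x)\mid x\in\mathfrak g_0\}$. Then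 $M(\varphi)$ is an irreducible $\mathfrak g$-module if and only if $$12(1+\lambda)\,\varphi(I_0)-(k^2-1)\,\varphi\big(C_{LI}^{(1)}\big)\,\delta_{\lambda,1}\neq 0\quad\text{for every nonzero integer }k.$$ -/

import Mathlib

/-- Labels of the basis vectors `L_n`, `I_n` (`n : ℤ`), `C_L`, `C_LI^(1)` of the deformed
Heisenberg-Virasoro algebra. -/
inductive DHVIndex : Type
  | L (n : ℤ)
  | I (n : ℤ)
  | CL
  | CLI

/-- The deformed Heisenberg-Virasoro algebra `𝔤(ℤ, lam)` (meant for `lam ≠ 0, -1`):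
the complex vector space with basis `L_n`, `I_n` (`n : ℤ`), `C_L`, `C_LI^(1)`; its Lie bracket,
which depends on `lam`, is given below. -/
def DHV (_lam : ℂ) : Type := DHVIndex →₀ ℂ

noncomputable section

namespace DHV

instance (lam : ℂ) : AddCommGroup (DHV lam) := inferInstanceAs (AddCommGroup (DHVIndex →₀ ℂ))

instance (lam : ℂ) : Module ℂ (DHV lam) := inferInstanceAs (Module ℂ (DHVIndex →₀ ℂ))

/-- The defining basis of `𝔤(ℤ, lam)`. -/
def basis (lam : ℂ) : Module.Basis DHVIndex ℂ (DHV lam) := Module.Basis.ofRepr (LinearEquiv.refl ℂ _)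

/-- The basis vector `L_n`. -/
def L (lam : ℂ) (n : ℤ) : DHV lam := basis lam (DHVIndex.L n)

/-- The basis vector `I_n`. -/
def I (lam : ℂ) (n : ℤ) : DHV lam := basis lam (DHVIndex.I n)

/-- The central basis vector `C_L`. -/
def CL (lam : ℂ) : DHV lam := basis lam DHVIndex.CL

/-- The central basis vector `C_LI^(1)`. -/
def CLI (lam : ℂ) : DHV lam := basis lam DHVIndex.CLI

/-- The Kronecker delta of two complex numbers. -/
def delta (x y : ℂ) : ℂ := open Classical in if x = y then 1 else 0

/-- The brackets of the basis vectors: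
`[L_m, L_n] = (n - m) L_{m+n} + (m³ - m)/12 δ_{m+n,0} C_L`,
`[L_m, I_n] = (n - lam m) I_{m+n} + (m³ - m)/12 δ_{lam,1} δ_{m+n,0} C_LI^(1)`, `[I_m, I_n] = 0`,
and `C_L`, `C_LI^(1)` are central. -/
def bracketBasis (lam : ℂ) : DHVIndex → DHVIndex → DHV lam
  | .L m, .L n => ((n : ℂ) - m) • L lam (m + n)
      + ((1 / 12 : ℂ) * ((m : ℂ) ^ 3 - m) * (if m + n = 0 then 1 else 0)) • CL lam
  | .L m, .I n => ((n : ℂ) - lam * m) • I lam (m + n)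
      + ((1 / 12 : ℂ) * ((m : ℂ) ^ 3 - m) * delta lam 1 * (if m + n = 0 then 1 else 0)) • CLI lam
  | .I m, .L n => -(((m : ℂ) - lam * n) • I lam (n + m)
      + ((1 / 12 : ℂ) * ((n : ℂ) ^ 3 - n) * delta lam 1 * (if n + m = 0 then 1 else 0)) • CLI lam)
  | _, _ => 0

/-- The bracket of `𝔤(ℤ, lam)`, extended bilinearly from the basis. -/
def bracketMap (lam : ℂ) : DHV lam →ₗ[ℂ] DHV lam →ₗ[ℂ] DHV lam :=
  (basis lam).constr ℂ fun i => (basis lam).constr ℂ fun j => bracketBasis lam i j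

instance (lam : ℂ) : Bracket (DHV lam) (DHV lam) := ⟨fun x y => bracketMap lam x y⟩

theorem bracket_def (lam : ℂ) (x y : DHV lam) : ⁅x, y⁆ = bracketMap lam x y := rfl

theorem bracketMap_basis (lam : ℂ) (i j : DHVIndex) :
    bracketMap lam (basis lam i) (basis lam j) = bracketBasis lam i j := by
  simp [bracketMap, Module.Basis.constr_basis]

theorem bracketMap_L_L (lam : ℂ) (m n : ℤ) : bracketMap lam (L lam m) (L lam n) =
    ((n : ℂ) - m) • L lam (m + n)
      + ((1 / 12 : ℂ) * ((m : ℂ) ^ 3 - m) * (if m + n = 0 then 1 else 0)) • CL lam :=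
  bracketMap_basis lam _ _

theorem bracketMap_L_I (lam : ℂ) (m n : ℤ) : bracketMap lam (L lam m) (I lam n) =
    ((n : ℂ) - lam * m) • I lam (m + n)
      + ((1 / 12 : ℂ) * ((m : ℂ) ^ 3 - m) * delta lam 1 * (if m + n = 0 then 1 else 0)) • CLI lam :=
  bracketMap_basis lam _ _

theorem bracketMap_I_L (lam : ℂ) (m n : ℤ) : bracketMap lam (I lam m) (L lam n) =
    -(((m : ℂ) - lam * n) • I lam (n + m)
      + ((1 / 12 : ℂ) * ((n : ℂ) ^ 3 - n) * delta lam 1 * (if n + m = 0 then 1 else 0)) • CLI lam) :=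
  bracketMap_basis lam _ _

theorem bracketMap_I_I (lam : ℂ) (m n : ℤ) : bracketMap lam (I lam m) (I lam n) = 0 :=
  bracketMap_basis lam _ _

theorem bracketMap_CL_left (lam : ℂ) (y : DHV lam) : bracketMap lam (CL lam) y = 0 := by
  have h : bracketMap lam (CL lam) = 0 := by
    refine (basis lam).ext fun j => ?_
    rw [CL, bracketMap_basis]; cases j <;> rfl
  rw [h]; rfl

theorem bracketMap_CLI_left (lam : ℂ) (y : DHV lam) : bracketMap lam (CLI lam) y = 0 := by
  have h : bracketMap lam (CLI lam) = 0 := by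
    refine (basis lam).ext fun j => ?_
    rw [CLI, bracketMap_basis]; cases j <;> rfl
  rw [h]; rfl

theorem bracketMap_CL_right (lam : ℂ) (x : DHV lam) : bracketMap lam x (CL lam) = 0 := by
  have h : (bracketMap lam).flip (CL lam) = 0 := by
    refine (basis lam).ext fun j => ?_
    rw [LinearMap.flip_apply, CL, bracketMap_basis]; cases j <;> rfl
  exact LinearMap.congr_fun h x

theorem bracketMap_CLI_right (lam : ℂ) (x : DHV lam) : bracketMap lam x (CLI lam) = 0 := by
  have h : (bracketMap lam).flip (CLI lam) = 0 := by
    refine (basis lam).ext fun j => ?_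
    rw [LinearMap.flip_apply, CLI, bracketMap_basis]; cases j <;> rfl
  exact LinearMap.congr_fun h x

theorem basis_L (lam : ℂ) (n : ℤ) : basis lam (.L n) = L lam n := rfl
theorem basis_I (lam : ℂ) (n : ℤ) : basis lam (.I n) = I lam n := rfl
theorem basis_CL (lam : ℂ) : basis lam .CL = CL lam := rfl
theorem basis_CLI (lam : ℂ) : basis lam .CLI = CLI lam := rfl

theorem bracketMap_swap (lam : ℂ) (x y : DHV lam) : bracketMap lam x y = -bracketMap lam y x := by
  have h : bracketMap lam = -(bracketMap lam).flip := by
    refine (basis lam).ext fun i => (basis lam).ext fun j => ?_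
    cases i <;> cases j <;>
      simp only [basis_L, basis_I, basis_CL, basis_CLI, LinearMap.neg_apply, LinearMap.flip_apply,
        bracketMap_L_L, bracketMap_L_I, bracketMap_I_L, bracketMap_I_I, bracketMap_CL_left,
        bracketMap_CLI_left, bracketMap_CL_right, bracketMap_CLI_right, neg_zero, neg_neg]
    rename_i m n
    rw [add_comm n m]
    by_cases hmn : m + n = 0
    · obtain rfl : n = -m := by omega
      push_cast
      module
    · simp only [hmn, if_false]
      module
  exact LinearMap.congr_fun (LinearMap.congr_fun h x) y

theorem basis_induction (lam : ℂ) {p : DHV lam → Prop} (hb : ∀ i, p (basis lam i))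
    (hadd : ∀ x y, p x → p y → p (x + y)) (hsmul : ∀ (c : ℂ) (x), p x → p (c • x))
    (x : DHV lam) : p x := by
  have hx := (basis lam).mem_span x
  induction hx using Submodule.span_induction with
  | mem x hx => obtain ⟨i, rfl⟩ := hx; exact hb i
  | zero => simpa using hsmul 0 _ (hb .CL)
  | add x y _ _ hx hy => exact hadd x y hx hy
  | smul c x _ hx => exact hsmul c x hx

theorem bracketMap_jacobi_basis (lam : ℂ) (i j k : DHVIndex) :
    bracketMap lam (basis lam i) (bracketMap lam (basis lam j) (basis lam k)) =
      bracketMap lam (bracketMap lam (basis lam i) (basis lam j)) (basis lam k) +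
        bracketMap lam (basis lam j) (bracketMap lam (basis lam i) (basis lam k)) := by
  cases i <;> cases j <;> cases k <;>
    simp only [basis_L, basis_I, basis_CL, basis_CLI, map_add, map_smul, map_neg, map_zero,
      LinearMap.add_apply, LinearMap.smul_apply, LinearMap.neg_apply, LinearMap.zero_apply,
      bracketMap_L_L, bracketMap_L_I, bracketMap_I_L, bracketMap_I_I, bracketMap_CL_left,
      bracketMap_CLI_left, bracketMap_CL_right, bracketMap_CLI_right, neg_zero, smul_zero, add_zero]
  all_goals
    rename_i m n k
    have e1 : (m + n) + k = m + (n + k) := by ring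
    have e2 : n + (m + k) = m + (n + k) := by ring
    have e3 : k + (m + n) = m + (n + k) := by ring
    have e4 : m + (k + n) = m + (n + k) := by ring
    have e5 : n + (k + m) = m + (n + k) := by ring
    have e6 : (n + k) + m = m + (n + k) := by ring
    have e7 : k + (n + m) = m + (n + k) := by ring
    have e8 : (m + k) + n = m + (n + k) := by ring
    simp only [e1, e2, e3, e4, e5, e6, e7, e8]
    by_cases h : m + (n + k) = 0
    · obtain rfl : k = -m - n := by omega
      simp only [h, if_true]
      push_cast
      first
        | module
        | by_cases hl : lam = 1
          · subst hl
            module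
          · simp only [delta, hl, if_false]
            module
    · simp only [h, if_false]
      push_cast
      module

theorem bracketMap_jacobi (lam : ℂ) (x y z : DHV lam) :
    bracketMap lam x (bracketMap lam y z) =
      bracketMap lam (bracketMap lam x y) z + bracketMap lam y (bracketMap lam x z) := by
  induction x using basis_induction with
  | hadd x x' hx hx' => simp only [map_add, LinearMap.add_apply, hx, hx']; abel
  | hsmul c x hx => simp only [map_smul, LinearMap.smul_apply, hx, smul_add]
  | hb i =>
    induction y using basis_induction with
    | hadd y y' hy hy' => simp only [map_add, LinearMap.add_apply, hy, hy']; abel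
    | hsmul c y hy => simp only [map_smul, LinearMap.smul_apply, hy, smul_add]
    | hb j =>
      induction z using basis_induction with
      | hadd z z' hz hz' => simp only [map_add, hz, hz']; abel
      | hsmul c z hz => simp only [map_smul, hz, smul_add]
      | hb k => exact bracketMap_jacobi_basis lam i j k

instance (lam : ℂ) : LieRing (DHV lam) where
  add_lie x y z := by simp [bracket_def]
  lie_add x y z := by simp [bracket_def]
  lie_self x := by
    have h := bracketMap_swap lam x x
    have h2 : (2 : ℂ) • bracketMap lam x x = 0 := by
      rw [two_smul]; nth_rewrite 1 [h]; exact neg_add_cancel _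
    rw [bracket_def]
    exact (smul_eq_zero.mp h2).resolve_left two_ne_zero
  leibniz_lie x y z := bracketMap_jacobi lam x y z

instance (lam : ℂ) : LieAlgebra ℂ (DHV lam) where
  lie_smul t x y := by simp [bracket_def]

/-- The degree zero part `𝔤_0` of `𝔤(ℤ, lam)`, spanned by `L_0`, `I_0`, `C_L`, `C_LI^(1)`. -/
def zeroPart (lam : ℂ) : Submodule ℂ (DHV lam) :=
  Submodule.span ℂ {L lam 0, I lam 0, CL lam, CLI lam}

/-- `I_0` as an element of `𝔤_0`. -/
def zeroPartI (lam : ℂ) : zeroPart lam := ⟨I lam 0, Submodule.subset_span (by simp)⟩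

/-- `C_LI^(1)` as an element of `𝔤_0`. -/
def zeroPartCLI (lam : ℂ) : zeroPart lam := ⟨CLI lam, Submodule.subset_span (by simp)⟩

/-- The universal enveloping algebra `U(𝔤)` of `𝔤 = 𝔤(ℤ, lam)`. -/
abbrev U (lam : ℂ) : Type := UniversalEnvelopingAlgebra ℂ (DHV lam)

/-- The left ideal of `U(𝔤)` generated by `L_n`, `I_n` for `n > 0` and by `x - φ(x)` for
`x ∈ 𝔤_0`. -/
def vermaIdeal (lam : ℂ) (φ : zeroPart lam →ₗ[ℂ] ℂ) : Submodule (U lam) (U lam) :=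
  Submodule.span (U lam)
    ({u | ∃ n : ℤ, 0 < n ∧ (u = UniversalEnvelopingAlgebra.ι ℂ (L lam n) ∨
        u = UniversalEnvelopingAlgebra.ι ℂ (I lam n))} ∪
      {u | ∃ x : zeroPart lam,
        u = UniversalEnvelopingAlgebra.ι ℂ (x : DHV lam) - algebraMap ℂ (U lam) (φ x)})

/-- The Verma module `M(φ) = U(𝔤) / I(φ)` with highest weight `φ`, as a left `U(𝔤)`-module
(equivalently, a `𝔤`-module). -/
abbrev Verma (lam : ℂ) (φ : zeroPart lam →ₗ[ℂ] ℂ) : Type := U lam ⧸ vermaIdeal lam φ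

end DHV

end

/-! The Verma module has a basis of ordered monomials: letters `L_{-a}` to the left of letters
`I_{-b}`, applied to the vacuum. It is realised as an explicit `Model`, obtained from a
straightening recursion as in the PBW theorem, and `mem_vermaIdeal_iff` identifies `U(𝔤)/I(φ)` with
it. Irreducibility is governed by the scalars `pairing φ n`, by which `[L_m, I_{-m}]`, `m = n + 1`,
acts on the vacuum. By `pairing_eq_mul` each is a nonzero multiple of the expression in the theorem
at `k = m`, and only `k²` enters there.

Suppose no pairing vanishes. On polynomials in the `I_{-b}` with `b ≤ m`, `L_m` acts as the pairing
times the derivative in `I_{-m}` (`opL_top_of_allX`). On monomials whose letters `L_{-a}` have `a ≤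
m`, `I_m` acts, up to terms with fewer letters `L`, as the pairing times the derivative in `L_{-m}`
(`opI_top_mem_filL`). Choosing `m` as the largest relevant index in a vector that is not a multiple
of the vacuum gives a nonzero vector of smaller weight, so every nonzero submodule reaches the
vacuum (`vacuum_mem_of_pairing_ne_zero`).

Suppose the pairing at `m` vanishes. Then `L_m` kills every polynomial of weight `m` in the letters
`I`. Testing these polynomials against the words in positive `L`'s indexed by partitions of `m` is a
square linear system with a zero row, so it has a nonzero solution. Reordering a word only costs
shorter words, and positive `I`'s kill such polynomials, so the solution lies in `radical`, a
submodule that misses the vacuum (`radical_ne_bot`). -/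

/-! ### Modules induced from a character of a subalgebra -/

namespace CharInd

attribute [local instance] LieRing.ofAssociativeRing

open Finsupp

section Defs

variable {R : Type*} {N P : Type*}

/-- The total degree of a monomial, for letters of degree `d`. -/
def deg (d : N ⊕ P → ℕ) (K : Multiset N) : ℕ := (K.map fun a => d (.inl a)).sum

@[simp] theorem deg_zero (d : N ⊕ P → ℕ) : deg d 0 = 0 := rfl

@[simp] theorem deg_cons (d : N ⊕ P → ℕ) (a : N) (K : Multiset N) :
    deg d (a ::ₘ K) = d (.inl a) + deg d K := by simp [deg]

variable (R) [CommRing R] in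
/-- The leading term of the action of the letter `i` on the monomial `K`. -/
noncomputable def leading : N ⊕ P → Multiset N → (Multiset N →₀ R)
  | .inl a, K => single (a ::ₘ K) 1
  | .inr _, _ => 0

theorem leading_mem [CommRing R] (d : N ⊕ P → ℕ) (i : N ⊕ P) (K : Multiset N) :
    leading R i K ∈ supported R R {S | S.card ≤ K.card + 1 ∧ deg d S ≤ d i + deg d K} := by
  cases i with
  | inl a => exact single_mem_supported R 1 ⟨by simp, by simp⟩
  | inr p => exact zero_mem _

variable [LinearOrder N]

/-- The letter `i` belongs to `N` and is at most every letter of `K`. -/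
def Precedes : N ⊕ P → Multiset N → Prop
  | .inl a, K => ∀ c ∈ K, a ≤ c
  | .inr _, _ => False

theorem exists_min_cons {K : Multiset N} (hK : K ≠ 0) :
    ∃ j T, K = j ::ₘ T ∧ ∀ a ∈ T, j ≤ a := by
  have hne : K.toFinset.Nonempty := by
    simpa [Finset.nonempty_iff_ne_empty] using hK
  have hmem : K.toFinset.min' hne ∈ K := Multiset.mem_toFinset.1 (Finset.min'_mem _ hne)
  refine ⟨_, _, (Multiset.cons_erase hmem).symm, fun a ha => ?_⟩
  exact Finset.min'_le _ _ (Multiset.mem_toFinset.2 (Multiset.mem_of_mem_erase ha))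

theorem min_cons_unique {j j' : N} {T T' : Multiset N} (h : j ::ₘ T = j' ::ₘ T')
    (hj : ∀ a ∈ T, j ≤ a) (hj' : ∀ a ∈ T', j' ≤ a) : j = j' ∧ T = T' := by
  have h1 : j ∈ j' ::ₘ T' := h ▸ Multiset.mem_cons_self j T
  have h2 : j' ∈ j ::ₘ T := h ▸ Multiset.mem_cons_self j' T'
  have e : j = j' := by
    rcases Multiset.mem_cons.1 h1 with e | e1
    · exact e
    · rcases Multiset.mem_cons.1 h2 with e | e2
      · exact e.symm
      · exact le_antisymm (hj _ e2) (hj' _ e1)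
  subst e
  exact ⟨rfl, (Multiset.cons_inj_right j).1 h⟩

theorem precedes_inl {a : N} {K : Multiset N} :
    Precedes (.inl a : N ⊕ P) K ↔ ∀ c ∈ K, a ≤ c := Iff.rfl

end Defs

/-! ### Straightening: basis vectors acting on ordered monomials -/

variable {R 𝔤 N P : Type*} [CommRing R] [LieRing 𝔤] [LieAlgebra R 𝔤] [LinearOrder N]
  (b : Module.Basis (N ⊕ P) R 𝔤) (χ : P → R)

open Classical in
/-- The action of a basis element on a monomial. -/
noncomputable def act (i : N ⊕ P) (K : Multiset N) : Multiset N →₀ R :=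
  if Precedes i K then leading R i K
  else if hK : ∃ j T, K = j ::ₘ T ∧ ∀ a ∈ T, j ≤ a then
    have : hK.choose_spec.choose.card < K.card := by
      have h := congrArg Multiset.card hK.choose_spec.choose_spec.1
      rw [Multiset.card_cons] at h
      omega
    -- Straightening `b i * b j * T = b j * b i * T + [b i, b j] * T`. The leading part of `b i * T`
    -- contributes `leading R i K`. The size test on the remaining terms serves termination only; it
    -- always succeeds by `act_sub_leading_mem`.
    leading R i K
      + ((act i hK.choose_spec.choose - leading R i hK.choose_spec.choose).sum fun S c =>
          if _ : S.card < K.card then c • act (.inl hK.choose) S else 0)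
      + (b.repr ⁅b i, b (.inl hK.choose)⁆).sum fun k c => c • act k hK.choose_spec.choose
  -- The monomial is empty here, and every letter precedes it, so the value `0` is never used.
  else i.elim (fun _ => 0) fun p => single 0 (χ p)
termination_by K.card

theorem act_of_precedes {i : N ⊕ P} {K : Multiset N} (h : Precedes i K) :
    act b χ i K = leading R i K := by
  rw [act, if_pos h]

theorem act_inr_zero (p : P) : act b χ (.inr p) 0 = single 0 (χ p) := by
  rw [act, if_neg (by exact id), dif_neg]
  · rfl
  · rintro ⟨j, T, h, -⟩
    exact Multiset.cons_ne_zero h.symm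

theorem act_cons {i : N ⊕ P} {j : N} {T : Multiset N} (hj : ∀ a ∈ T, j ≤ a)
    (hi : ¬ Precedes i (j ::ₘ T)) :
    act b χ i (j ::ₘ T) = leading R i (j ::ₘ T)
      + ((act b χ i T - leading R i T).sum fun S c =>
          if S.card < (j ::ₘ T).card then c • act b χ (.inl j) S else 0)
      + (b.repr ⁅b i, b (.inl j)⁆).sum fun k c => c • act b χ k T := by
  have hK : ∃ j' T', j ::ₘ T = j' ::ₘ T' ∧ ∀ a ∈ T', j' ≤ a := ⟨j, T, rfl, hj⟩
  obtain ⟨e1, e2⟩ := min_cons_unique hK.choose_spec.choose_spec.1 hj hK.choose_spec.choose_spec.2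
  rw [act, if_neg hi, dif_pos hK]
  simp only [← e2]
  simp only [← e1, dite_eq_ite]

/-- The action of a basis element agrees with its leading term up to monomials of lower degree. -/
theorem act_sub_leading_mem (d : N ⊕ P → ℕ)
    (hd : ∀ i j k, b.repr ⁅b i, b j⁆ k ≠ 0 → d k ≤ d i + d j) (i : N ⊕ P) (K : Multiset N) :
    act b χ i K - leading R i K ∈
      supported R R {S | S.card ≤ K.card ∧ deg d S ≤ d i + deg d K} := by
  induction hn : K.card using Nat.strong_induction_on generalizing i K with
  | _ n ih =>
    subst hn
    by_cases hi : Precedes i K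
    · rw [act_of_precedes b χ hi, sub_self]; exact zero_mem _
    by_cases hK : K = 0
    · subst hK
      cases i with
      | inl a => exact absurd (fun c hc => absurd hc (Multiset.notMem_zero c)) hi
      | inr p =>
        rw [act_inr_zero]
        simp only [leading, sub_zero]
        exact single_mem_supported R _ ⟨le_rfl, by simp⟩
    · obtain ⟨j, T, rfl, hj⟩ := exists_min_cons hK
      have hT : T.card < (j ::ₘ T).card := by simp
      have key : ∀ (k : N ⊕ P) (S : Multiset N), S.card ≤ T.card →
          act b χ k S ∈ supported R R {S' | S'.card ≤ S.card + 1 ∧ deg d S' ≤ d k + deg d S} := by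
        intro k S hS
        have h1 := ih S.card (by omega) k S rfl
        rw [← sub_add_cancel (act b χ k S) (leading R k S)]
        refine add_mem (supported_mono ?_ h1) (leading_mem d k S)
        exact fun S' h => ⟨h.1.trans (Nat.le_succ _), h.2⟩
      rw [act_cons b χ hj hi, add_assoc, add_sub_cancel_left]
      refine add_mem (Submodule.finsuppSum_mem _ _ _ _ fun S hS => ?_)
        (Submodule.finsuppSum_mem _ _ _ _ fun k hk => ?_)
      · have h1 := (mem_supported R _).1 (ih T.card hT i T rfl)
          (Finset.mem_coe.2 (Finsupp.mem_support_iff.2 hS))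
        rw [if_pos (lt_of_le_of_lt h1.1 hT)]
        refine Submodule.smul_mem _ _ (supported_mono ?_ (key (.inl j) S h1.1))
        rintro S' ⟨h2, h3⟩
        have := h1.1
        have := h1.2
        simp only [Set.mem_ofPred_eq, Multiset.card_cons, deg_cons]
        omega
      · refine Submodule.smul_mem _ _ (supported_mono ?_ (key k T le_rfl))
        rintro S' ⟨h2, h3⟩
        have := hd _ _ _ hk
        simp only [Set.mem_ofPred_eq, Multiset.card_cons, deg_cons]
        omega

theorem act_mem (d : N ⊕ P → ℕ)
    (hd : ∀ i j k, b.repr ⁅b i, b j⁆ k ≠ 0 → d k ≤ d i + d j) (i : N ⊕ P) (K : Multiset N) :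
    act b χ i K ∈ supported R R {S | deg d S ≤ d i + deg d K} := by
  rw [← sub_add_cancel (act b χ i K) (leading R i K)]
  exact add_mem (supported_mono (fun _ h => h.2) (act_sub_leading_mem b χ d hd i K))
    (supported_mono (fun _ h => h.2) (leading_mem d i K))

/-- The action of a basis element. -/
noncomputable def op (i : N ⊕ P) : Module.End R (Multiset N →₀ R) :=
  linearCombination R (act b χ i)

theorem op_single (i : N ⊕ P) (K : Multiset N) : op b χ i (single K 1) = act b χ i K := by
  simp [op]

/-- The action of the Lie algebra on the induced module. -/
noncomputable def opMap : 𝔤 →ₗ[R] Module.End R (Multiset N →₀ R) := b.constr R (op b χ)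

theorem opMap_basis (i : N ⊕ P) : opMap b χ (b i) = op b χ i := b.constr_basis R _ i

theorem opMap_apply_single (x : 𝔤) (K : Multiset N) :
    opMap b χ x (single K 1) = (b.repr x).sum fun k c => c • act b χ k K := by
  rw [opMap, Module.Basis.constr_apply, Finsupp.sum, LinearMap.sum_apply]
  exact Finset.sum_congr rfl fun k _ => by rw [LinearMap.smul_apply, op_single]

/-- If a letter `i` fails to precede `j ::ₘ T` while `j` is below `T`, then `j ≤ i`; hence `j` can
simply be put in front of `i ::ₘ T`. -/
theorem op_leading_of_lt {i : N ⊕ P} {j : N} {T : Multiset N} (hj : ∀ a ∈ T, j ≤ a)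
    (hi : ¬ Precedes i (j ::ₘ T)) :
    op b χ (.inl j) (leading R i T) = leading R i (j ::ₘ T) := by
  cases i with
  | inr p => exact map_zero _
  | inl a =>
    simp only [leading, op_single]
    rw [act_of_precedes, leading, Multiset.cons_swap]
    intro c hc
    rcases Multiset.mem_cons.1 hc with rfl | hc
    · by_contra h
      refine hi fun e he => ?_
      rcases Multiset.mem_cons.1 he with rfl | he
      · exact (not_le.1 h).le
      · exact (not_le.1 h).le.trans (hj _ he)
    · exact hj _ hc

theorem op_sub_leading_mem (i : N ⊕ P) (K : Multiset N) :
    op b χ i (single K 1) - leading R i K ∈ supported R R {S | S.card ≤ K.card} := by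
  rw [op_single]
  exact supported_mono (fun _ h => h.1)
    (act_sub_leading_mem b χ 0 (fun _ _ _ _ => Nat.zero_le _) i K)

/-- This is the recursion clause of `act` read as a bracket relation, with the size test discharged.
-/
theorem op_op_of_lt {i : N ⊕ P} {j : N} {T : Multiset N} (hj : ∀ a ∈ T, j ≤ a)
    (hi : ¬ Precedes i (j ::ₘ T)) :
    op b χ i (op b χ (.inl j) (single T 1)) = op b χ (.inl j) (op b χ i (single T 1))
      + opMap b χ ⁅b i, b (.inl j)⁆ (single T 1) := by
  have h1 : op b χ (.inl j) (single T 1) = single (j ::ₘ T) 1 := by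
    rw [op_single, act_of_precedes b χ (precedes_inl.2 hj), leading]
  rw [h1, op_single, act_cons b χ hj hi, opMap_apply_single]
  congr 1
  have h2 : op b χ (.inl j) (act b χ i T - leading R i T) =
      (act b χ i T - leading R i T).sum fun S c =>
          if S.card < (j ::ₘ T).card then c • act b χ (.inl j) S else 0 := by
    rw [op, linearCombination_apply]
    refine Finset.sum_congr rfl fun S hS => ?_
    have h3 := (mem_supported R _).1 (op_sub_leading_mem b χ i T)
    rw [op_single] at h3
    have h4 : S.card ≤ T.card := h3 (Finset.mem_coe.2 hS)
    exact (if_pos (by simpa using Nat.lt_succ_of_le h4)).symm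
  rw [← h2, op_single, map_sub, op_leading_of_lt b χ hj hi]
  abel

/-- The vectors on which the bracket relation holds. -/
noncomputable def bracketLocus : Submodule R (Multiset N →₀ R) where
  carrier := {x | ∀ y z : 𝔤, opMap b χ y (opMap b χ z x) =
    opMap b χ z (opMap b χ y x) + opMap b χ ⁅y, z⁆ x}
  add_mem' {u v} hu hv y z := by simp only [map_add, hu y z, hv y z]; abel
  zero_mem' y z := by simp
  smul_mem' c u hu y z := by simp only [map_smul, hu y z, smul_add]

theorem mem_bracketLocus_of_basis {x : Multiset N →₀ R}
    (h : ∀ i j, op b χ i (op b χ j x) = op b χ j (op b χ i x) + opMap b χ ⁅b i, b j⁆ x) :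
    x ∈ bracketLocus b χ := by
  intro y z
  induction b.mem_span y using Submodule.span_induction with
  | zero => simp
  | add y y' _ _ hy hy' =>
    simp only [map_add, LinearMap.add_apply, hy, hy', add_lie]; abel
  | smul c y _ hy => simp only [map_smul, LinearMap.smul_apply, hy, smul_add, smul_lie]
  | mem y hy =>
    obtain ⟨i, rfl⟩ := hy
    induction b.mem_span z using Submodule.span_induction with
    | zero => simp
    | add z z' _ _ hz hz' =>
      simp only [map_add, LinearMap.add_apply, hz, hz', lie_add]; abel
    | smul c z _ hz => simp only [map_smul, LinearMap.smul_apply, hz, smul_add, lie_smul]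
    | mem z hz =>
      obtain ⟨j, rfl⟩ := hz
      simp only [opMap_basis]
      exact h i j

theorem op_swap {i j : N ⊕ P} {x : Multiset N →₀ R}
    (h : op b χ i (op b χ j x) = op b χ j (op b χ i x) + opMap b χ ⁅b i, b j⁆ x) :
    op b χ j (op b χ i x) = op b χ i (op b χ j x) + opMap b χ ⁅b j, b i⁆ x := by
  rw [h, ← lie_skew (b i) (b j), map_neg, LinearMap.neg_apply]
  abel

/-- One of the two letters is the least letter of an ordered monomial over `T`, so the recursion
clause applies to the pair, possibly after exchanging the roles of `i` and `j`. -/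
theorem op_op_of_precedes {i j : N ⊕ P} {T : Multiset N} (hi : Precedes i T) :
    op b χ i (op b χ j (single T 1)) =
      op b χ j (op b χ i (single T 1)) + opMap b χ ⁅b i, b j⁆ (single T 1) := by
  cases i with
  | inr p => exact hi.elim
  | inl a =>
    by_cases hj : Precedes j (a ::ₘ T)
    · cases j with
      | inr p => exact hj.elim
      | inl c =>
        rcases (hj a (Multiset.mem_cons_self a T)).eq_or_lt with rfl | hca
        · simp
        · refine op_op_of_lt b χ (fun e he => hj e (Multiset.mem_cons_of_mem he)) fun h => ?_
          exact absurd (h c (Multiset.mem_cons_self c T)) (not_le.2 hca)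
    · exact op_swap b χ (op_op_of_lt b χ hi hj)

/-! ### The bracket relations hold on the whole module -/

variable {b χ}

/-- The character condition: the bracket of two elements of the subalgebra kills the vacuum. -/
def IsChar (b : Module.Basis (N ⊕ P) R 𝔤) (χ : P → R) : Prop :=
  ∀ p q : P, b.constr R (fun i => act b χ i 0) ⁅b (.inr p), b (.inr q)⁆ = 0

/-- The PBW argument, by induction on length. The direct cases are the recursion and, on the vacuum,
the character condition. Otherwise the least letter `k` is split off and the relation for `i, j`
follows from those on shorter vectors and the Jacobi identity. -/
theorem bracketLocus_eq_top (hχ : IsChar b χ) : bracketLocus b χ = ⊤ := by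
  suffices h : ∀ K : Multiset N, single K 1 ∈ bracketLocus b χ by
    rw [eq_top_iff, ← Finsupp.supported_univ, supported_eq_span_single, Submodule.span_le]
    rintro _ ⟨K, -, rfl⟩
    exact h K
  intro T
  induction hn : T.card using Nat.strong_induction_on generalizing T with
  | _ n ih =>
    subst hn
    refine mem_bracketLocus_of_basis b χ fun i j => ?_
    by_cases hi : Precedes i T
    · exact op_op_of_precedes b χ hi
    by_cases hj : Precedes j T
    · exact op_swap b χ (op_op_of_precedes b χ hj)
    by_cases hT : T = 0
    · subst hT
      cases i with
      | inl a => exact absurd (fun c hc => absurd hc (Multiset.notMem_zero c)) hi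
      | inr p =>
      cases j with
      | inl a => exact absurd (fun c hc => absurd hc (Multiset.notMem_zero c)) hj
      | inr q =>
        have h1 : ∀ r : P, op b χ (.inr r) (single 0 1) = χ r • single 0 1 := fun r => by
          rw [op_single, act_inr_zero, smul_single, smul_eq_mul, mul_one]
        have h2 : opMap b χ ⁅b (.inr p), b (.inr q)⁆ (single 0 1) = 0 := by
          rw [← hχ p q, opMap_apply_single, Module.Basis.constr_apply]
        rw [h1, h1, map_smul, map_smul, h1, h1, h2, add_zero, smul_comm]
    · obtain ⟨k, Q, rfl, hk⟩ := exists_min_cons hT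
      have hkQ : op b χ (.inl k) (single Q 1) = single (k ::ₘ Q) 1 := by
        rw [op_single, act_of_precedes b χ (precedes_inl.2 hk), leading]
      have hQ : single Q 1 ∈ bracketLocus b χ := ih _ (by simp) Q rfl
      have hlow : ∀ u ∈ supported R R {S : Multiset N | S.card ≤ Q.card},
          u ∈ bracketLocus b χ := by
        intro u hu
        rw [supported_eq_span_single] at hu
        refine Submodule.span_le.2 ?_ hu
        rintro _ ⟨S, hS, rfl⟩
        exact ih _ (by simpa using Nat.lt_succ_of_le hS) S rfl
      have hop : ∀ (x : N ⊕ P) (u), op b χ x u = opMap b χ (b x) u := fun x u => by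
        rw [opMap_basis]
      -- The leading monomial `y ::ₘ Q` is too long for the induction hypothesis, but `k` precedes
      -- it, so the relation there is already known; the rest of `y * Q` is short enough.
      have key : ∀ x y : N ⊕ P, ¬ Precedes y (k ::ₘ Q) →
          op b χ x (op b χ (.inl k) (op b χ y (single Q 1))) =
            op b χ (.inl k) (op b χ x (op b χ y (single Q 1)))
              + opMap b χ ⁅b x, b (.inl k)⁆ (op b χ y (single Q 1)) := by
        intro x y hy
        have e : op b χ y (single Q 1) =
            (op b χ y (single Q 1) - leading R y Q) + leading R y Q := by abel
        have h1 := hlow _ (op_sub_leading_mem b χ y Q) (b x) (b (.inl k))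
        simp only [← hop] at h1
        have h2 : op b χ x (op b χ (.inl k) (leading R y Q)) =
            op b χ (.inl k) (op b χ x (leading R y Q))
              + opMap b χ ⁅b x, b (.inl k)⁆ (leading R y Q) := by
          cases y with
          | inr p => simp [leading]
          | inl a =>
            refine op_swap b χ (op_op_of_precedes b χ (precedes_inl.2 fun c hc => ?_))
            rcases Multiset.mem_cons.1 hc with rfl | hc
            · by_contra h
              refine hy fun e he => ?_
              rcases Multiset.mem_cons.1 he with rfl | he
              · exact (not_le.1 h).le
              · exact (not_le.1 h).le.trans (hk _ he)
            · exact hk _ hc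
        rw [e]
        simp only [map_add]
        rw [h1, h2]
        abel
      have hA := op_op_of_lt b χ hk hi
      have hB := op_op_of_lt b χ hk hj
      have kij := key i j hj
      have kji := key j i hi
      have q1 := hQ (b i) (b j)
      have q2 := hQ ⁅b i, b (.inl k)⁆ (b j)
      have q3 := hQ (b i) ⁅b j, b (.inl k)⁆
      have q4 := hQ ⁅b i, b j⁆ (b (.inl k))
      simp only [← hop] at q1 q2 q3 q4
      have jac : ⁅⁅b i, b j⁆, b (.inl k)⁆ =
          ⁅⁅b i, b (.inl k)⁆, b j⁆ + ⁅b i, ⁅b j, b (.inl k)⁆⁆ := by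
        rw [leibniz_lie (b i), ← lie_skew ⁅b i, b (.inl k)⁆ (b j), lie_lie (b i) (b j),
          leibniz_lie (b i) (b j)]
        abel
      rw [← hkQ, hA, hB, map_add, map_add, kij, kji, q1, q3, q4, jac, q2]
      simp only [map_add, LinearMap.add_apply]
      abel

/-! ### The induced representation and its universal property -/

variable (b χ)

/-- The induced module as a representation. -/
noncomputable def rep (hχ : IsChar b χ) : 𝔤 →ₗ⁅R⁆ Module.End R (Multiset N →₀ R) :=
  { opMap b χ with
    map_lie' := by
      intro y z
      refine LinearMap.ext fun x => ?_
      have h : x ∈ bracketLocus b χ := by rw [bracketLocus_eq_top hχ]; trivial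
      change opMap b χ ⁅y, z⁆ x = opMap b χ y (opMap b χ z x) - opMap b χ z (opMap b χ y x)
      rw [h y z, add_sub_cancel_left] }

variable {b χ} (hχ : IsChar b χ)

theorem rep_apply (x : 𝔤) : rep b χ hχ x = opMap b χ x := rfl

theorem rep_rep (x y : 𝔤) (v : Multiset N →₀ R) :
    rep b χ hχ x (rep b χ hχ y v) = rep b χ hχ y (rep b χ hχ x v) + rep b χ hχ ⁅x, y⁆ v := by
  rw [LieHom.map_lie, LieRing.of_associative_ring_bracket]
  simp

theorem rep_inl_single {a : N} {K : Multiset N} (h : ∀ c ∈ K, a ≤ c) :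
    rep b χ hχ (b (.inl a)) (single K 1) = single (a ::ₘ K) 1 := by
  rw [rep_apply, opMap_basis, op_single, act_of_precedes b χ (precedes_inl.2 h), leading]

theorem rep_inr_vacuum (p : P) :
    rep b χ hχ (b (.inr p)) (single 0 1) = single 0 (χ p) := by
  rw [rep_apply, opMap_basis, op_single, act_inr_zero]

theorem rep_single_mem (d : N ⊕ P → ℕ)
    (hd : ∀ i j k, b.repr ⁅b i, b j⁆ k ≠ 0 → d k ≤ d i + d j) (i : N ⊕ P) (K : Multiset N) :
    rep b χ hχ (b i) (single K 1) ∈ supported R R {S | deg d S ≤ d i + deg d K} := by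
  rw [rep_apply, opMap_basis, op_single]
  exact act_mem b χ d hd i K

/-- The universal property of the induced module. -/
theorem exists_equivariant {M : Type*} [AddCommGroup M] [Module R M]
    (ρ : 𝔤 →ₗ⁅R⁆ Module.End R M) (v : M) (hv : ∀ p, ρ (b (.inr p)) v = χ p • v) :
    ∃ f : (Multiset N →₀ R) →ₗ[R] M, f (single 0 1) = v ∧
      ∀ x w, f (rep b χ hχ x w) = ρ x (f w) := by
  have hρ : ∀ x y w, ρ x (ρ y w) = ρ y (ρ x w) + ρ ⁅x, y⁆ w := fun x y w => by
    rw [LieHom.map_lie, LieRing.of_associative_ring_bracket]; simp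
  -- The only possible choice: a monomial goes to the ordered product of its letters applied to `v`.
  -- Equivariance follows by the same straightening induction.
  let g : Multiset N → M := fun K => (K.sort (· ≤ ·)).foldr (fun a w => ρ (b (.inl a)) w) v
  have g0 : g 0 = v := by simp [g]
  have gc : ∀ a K, (∀ c ∈ K, a ≤ c) → g (a ::ₘ K) = ρ (b (.inl a)) (g K) := fun a K h => by
    simp only [g]
    rw [Multiset.sort_cons _ _ _ h, List.foldr_cons]
  let f : (Multiset N →₀ R) →ₗ[R] M := linearCombination R g
  have fs : ∀ K, f (single K 1) = g K := fun K => by simp [f]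
  refine ⟨f, by rw [fs, g0], ?_⟩
  suffices h : ∀ K x, f (rep b χ hχ x (single K 1)) = ρ x (f (single K 1)) by
    intro x w
    induction w using Finsupp.induction_linear with
    | zero => simp
    | add u w hu hw => simp only [map_add, hu, hw]
    | single K c =>
      have : single K c = c • single K (1 : R) := by simp
      rw [this, map_smul, map_smul, map_smul, map_smul, h]
  intro K
  induction hn : K.card using Nat.strong_induction_on generalizing K with
  | _ n ih =>
    subst hn
    suffices h : ∀ i, f (rep b χ hχ (b i) (single K 1)) = ρ (b i) (f (single K 1)) by
      intro x
      induction b.mem_span x using Submodule.span_induction with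
      | zero => simp
      | add y y' _ _ hy hy' => simp only [map_add, LinearMap.add_apply, hy, hy']
      | smul c y _ hy => simp only [map_smul, LinearMap.smul_apply, hy]
      | mem y hy => obtain ⟨i, rfl⟩ := hy; exact h i
    intro i
    by_cases hi : Precedes i K
    · cases i with
      | inr p => exact hi.elim
      | inl a => rw [rep_inl_single hχ hi, fs, fs, gc _ _ hi]
    by_cases hK : K = 0
    · subst hK
      cases i with
      | inl a => exact absurd (fun c hc => absurd hc (Multiset.notMem_zero c)) hi
      | inr p =>
        have : single 0 (χ p) = χ p • single (0 : Multiset N) (1 : R) := by simp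
        rw [rep_inr_vacuum, this, map_smul, fs, g0, hv]
    · obtain ⟨j, T, rfl, hj⟩ := exists_min_cons hK
      have ihT := ih T.card (by simp) T rfl
      have hlow : ∀ u ∈ supported R R {S : Multiset N | S.card ≤ T.card}, ∀ x,
          f (rep b χ hχ x u) = ρ x (f u) := by
        intro u hu x
        rw [supported_eq_span_single] at hu
        induction hu using Submodule.span_induction with
        | zero => simp
        | add y y' _ _ hy hy' => simp only [map_add, hy, hy']
        | smul c y _ hy => simp only [map_smul, hy]
        | mem y hy =>
          obtain ⟨S, hS, rfl⟩ := hy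
          exact ih _ (by simpa using Nat.lt_succ_of_le hS) S rfl x
      have hlead : f (rep b χ hχ (b (.inl j)) (leading R i T)) =
          ρ (b (.inl j)) (f (leading R i T)) := by
        rw [rep_apply, opMap_basis, op_leading_of_lt b χ hj hi]
        cases i with
        | inr p => simp [leading]
        | inl a =>
          simp only [leading, fs]
          rw [Multiset.cons_swap, gc]
          intro c hc
          rcases Multiset.mem_cons.1 hc with rfl | hc
          · by_contra h
            refine hi fun e he => ?_
            rcases Multiset.mem_cons.1 he with rfl | he
            · exact (not_le.1 h).le
            · exact (not_le.1 h).le.trans (hj _ he)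
          · exact hj _ hc
      have hsplit : f (rep b χ hχ (b (.inl j)) (rep b χ hχ (b i) (single T 1))) =
          ρ (b (.inl j)) (f (rep b χ hχ (b i) (single T 1))) := by
        have h1 := op_sub_leading_mem b χ i T
        rw [← opMap_basis, ← rep_apply hχ] at h1
        have h2 := hlow _ h1 (b (.inl j))
        rw [map_sub, map_sub, map_sub, map_sub, hlead] at h2
        simpa using h2
      rw [← rep_inl_single hχ hj, rep_rep, map_add, hsplit, ihT, ihT, ihT, hρ (b i)]

end CharInd

/-! ### The model of the Verma module -/

namespace DHV

open Finsupp

attribute [local instance] LieRing.ofAssociativeRing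

noncomputable section

/-- Letters of the monomials spanning the Verma module: `inlₗ j` stands for `L_{-(j+1)}` and
`inrₗ j` for `I_{-(j+1)}`. -/
abbrev Letter : Type := ℕ ⊕ₗ ℕ

/-- The letter of `L_{-(j+1)}`. -/
abbrev yy (j : ℕ) : Letter := Sum.inlₗ j

/-- The letter of `I_{-(j+1)}`. -/
abbrev xx (j : ℕ) : Letter := Sum.inrₗ j

/-- The label of the basis vector denoted by a letter. -/
def negIndex (a : Letter) : DHVIndex :=
  Sum.elim (fun j : ℕ => .L (-(j + 1))) (fun j : ℕ => .I (-(j + 1))) (ofLex a)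

theorem letter_cases {p : Letter → Prop} (hy : ∀ j, p (yy j)) (hx : ∀ j, p (xx j)) (a : Letter) :
    p a := by
  rcases h : ofLex a with j | j
  · have e : a = yy j := congrArg toLex h
    rw [e]; exact hy j
  · have e : a = xx j := congrArg toLex h
    rw [e]; exact hx j

/-- The labels of the basis vectors of nonnegative degree. -/
def IsNonneg : DHVIndex → Prop
  | .L n => 0 ≤ n
  | .I n => 0 ≤ n
  | .CL => True
  | .CLI => True

/-- The labels, split by the sign of the degree. -/
def splitIndex : Letter ⊕ {i // IsNonneg i} → DHVIndex := Sum.elim negIndex Subtype.val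

theorem splitIndex_bijective : Function.Bijective splitIndex := by
  constructor
  · rintro (a | ⟨i, hi⟩) (a' | ⟨i', hi'⟩) h
    · induction a using letter_cases <;> induction a' using letter_cases <;>
        simp_all [splitIndex, negIndex]
    · induction a using letter_cases <;> simp only [splitIndex, negIndex, Sum.elim_inl,
        Sum.elim_inr, ofLex_toLex] at h <;> subst h <;> simp only [IsNonneg] at hi' <;> omega
    · induction a' using letter_cases <;> simp only [splitIndex, negIndex, Sum.elim_inl,
        Sum.elim_inr, ofLex_toLex] at h <;> subst h <;> simp only [IsNonneg] at hi <;> omega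
    · simp_all [splitIndex]
  · intro i
    by_cases hi : IsNonneg i
    · exact ⟨.inr ⟨i, hi⟩, rfl⟩
    · cases i with
      | L n =>
        simp only [IsNonneg, not_le] at hi
        refine ⟨.inl (yy (-n - 1).toNat), ?_⟩
        simp only [splitIndex, negIndex, Sum.elim_inl, ofLex_toLex, DHVIndex.L.injEq]
        omega
      | I n =>
        simp only [IsNonneg, not_le] at hi
        refine ⟨.inl (xx (-n - 1).toNat), ?_⟩
        simp only [splitIndex, negIndex, Sum.elim_inl, Sum.elim_inr, ofLex_toLex,
          DHVIndex.I.injEq]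
        omega
      | CL => exact absurd trivial hi
      | CLI => exact absurd trivial hi

/-- The defining basis, indexed compatibly with the triangular decomposition. -/
def triBasis (lam : ℂ) : Module.Basis (Letter ⊕ {i // IsNonneg i}) ℂ (DHV lam) :=
  (basis lam).reindex (Equiv.ofBijective _ splitIndex_bijective).symm

theorem triBasis_apply (lam : ℂ) (k) : triBasis lam k = basis lam (splitIndex k) := by
  simp [triBasis]

theorem triBasis_repr (lam : ℂ) (v : DHV lam) (k) :
    (triBasis lam).repr v k = (basis lam).repr v (splitIndex k) := by
  simp [triBasis]

variable {lam : ℂ} (φ : zeroPart lam →ₗ[ℂ] ℂ)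

/-- The extension by zero of `φ` to basis vectors of nonnegative degree. -/
def charVal : DHVIndex → ℂ
  | .L n => if n = 0 then φ ⟨L lam 0, Submodule.subset_span (by simp)⟩ else 0
  | .I n => if n = 0 then φ (zeroPartI lam) else 0
  | .CL => φ ⟨CL lam, Submodule.subset_span (by simp)⟩
  | .CLI => φ (zeroPartCLI lam)

/-- A bracket of basis vectors of nonnegative degree lands either in positive degree, where
`charVal` vanishes, or comes from two vectors of degree zero, where all structure constants vanish.
-/
theorem isChar : CharInd.IsChar (triBasis lam) fun p => charVal φ p.1 := by
  rintro ⟨i, hi⟩ ⟨j, hj⟩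
  have key : ∀ k, IsNonneg k →
      (triBasis lam).constr ℂ
        (fun i => CharInd.act (triBasis lam) (fun p => charVal φ p.1) i 0) (basis lam k) =
      single 0 (charVal φ k) := by
    intro k hk
    have : basis lam k = triBasis lam (.inr ⟨k, hk⟩) := by rw [triBasis_apply]; rfl
    rw [this, Module.Basis.constr_basis, CharInd.act_inr_zero]
  rw [triBasis_apply, triBasis_apply]
  generalize (triBasis lam).constr ℂ
    (fun i => CharInd.act (triBasis lam) (fun p => charVal φ p.1) i 0) = F at key ⊢
  have kL := fun n (hn : 0 ≤ n) => key (.L n) hn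
  have kI := fun n (hn : 0 ≤ n) => key (.I n) hn
  have kC := key .CL trivial
  have kCI := key .CLI trivial
  simp only [basis_L, basis_I, basis_CL, basis_CLI, charVal] at kL kI kC kCI
  simp only [splitIndex, Sum.elim_inr, bracket_def, bracketMap_basis]
  cases i <;> cases j <;> simp only [bracketBasis, map_zero]
  all_goals
    rename_i m n
    simp only [IsNonneg] at hi hj
    simp only [map_add, map_neg, map_smul]
    first | rw [kL _ (by omega), kC] | rw [kI _ (by omega), kCI]
    by_cases h : m + n = 0
    · obtain rfl : m = 0 := by omega
      obtain rfl : n = 0 := by omega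
      simp
    · have h' : n + m ≠ 0 := by omega
      simp [h, h']

/-- The number of letters `L_n` in a basis vector. -/
def lDeg : DHVIndex → ℕ
  | .L _ => 1
  | _ => 0

/-- Brackets involving an `I` contain no `L`, so counting letters `L` gives a filtration compatible
with the action. -/
theorem lDeg_le (lam : ℂ) (i j k : DHVIndex) (h : (basis lam).repr (bracketBasis lam i j) k ≠ 0) :
    lDeg k ≤ lDeg i + lDeg j := by
  cases k <;> try exact Nat.zero_le _
  cases i <;> cases j <;> simp_all [bracketBasis, lDeg, L, I, CL, CLI]

/-- The induced module, on which `𝔤` acts through `rho`. -/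
abbrev Model : Type := Multiset Letter →₀ ℂ

/-- The action of `𝔤` on the model of the Verma module. -/
def rho : DHV lam →ₗ⁅ℂ⁆ Module.End ℂ Model := CharInd.rep (triBasis lam) _ (isChar φ)

/-- The action of `L_n`. -/
def opL (n : ℤ) : Module.End ℂ Model := rho φ (L lam n)

/-- The action of `I_n`. -/
def opI (n : ℤ) : Module.End ℂ Model := rho φ (I lam n)

/-- The monomial basis of the model. -/
abbrev mon (K : Multiset Letter) : Model := single K 1

theorem model_induction {p : Model → Prop} (hmon : ∀ K, p (mon K))
    (hadd : ∀ u w, p u → p w → p (u + w)) (hsmul : ∀ (c : ℂ) u, p u → p (c • u)) (u : Model) :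
    p u := by
  induction u using Finsupp.induction_linear with
  | zero => simpa using hsmul 0 _ (hmon 0)
  | add u w hu hw => exact hadd u w hu hw
  | single K c => simpa using hsmul c _ (hmon K)

theorem mon_induction {p : Multiset Letter → Prop} (h0 : p 0)
    (hcons : ∀ a K, (∀ c ∈ K, a ≤ c) → p K → p (a ::ₘ K)) (K : Multiset Letter) : p K := by
  induction hn : K.card generalizing K with
  | zero => rw [Multiset.card_eq_zero.1 hn]; exact h0
  | succ n ih =>
    have hK : K ≠ 0 := by rintro rfl; simp at hn
    obtain ⟨j, T, rfl, hj⟩ := CharInd.exists_min_cons hK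
    exact hcons j T hj (ih T (by simpa using hn))

theorem rho_rho (x y : DHV lam) (v : Model) :
    rho φ x (rho φ y v) = rho φ y (rho φ x v) + rho φ ⁅x, y⁆ v :=
  CharInd.rep_rep (isChar φ) x y v

theorem opL_mon {j : ℕ} {K : Multiset Letter} (h : ∀ c ∈ K, yy j ≤ c) :
    opL φ (-(j + 1)) (mon K) = mon (yy j ::ₘ K) := by
  have := CharInd.rep_inl_single (isChar φ) h
  rwa [triBasis_apply] at this

theorem opI_mon {j : ℕ} {K : Multiset Letter} (h : ∀ c ∈ K, xx j ≤ c) :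
    opI φ (-(j + 1)) (mon K) = mon (xx j ::ₘ K) := by
  have := CharInd.rep_inl_single (isChar φ) h
  rwa [triBasis_apply] at this

theorem rho_vacuum {i : DHVIndex} (hi : IsNonneg i) :
    rho φ (basis lam i) (mon 0) = charVal φ i • mon 0 := by
  have := CharInd.rep_inr_vacuum (isChar φ) ⟨i, hi⟩
  rw [triBasis_apply] at this
  rw [smul_single, smul_eq_mul, mul_one]
  exact this

theorem opL_pos_vacuum {n : ℤ} (hn : 0 < n) : opL φ n (mon 0) = 0 := by
  have := rho_vacuum φ (i := .L n) hn.le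
  rwa [charVal, if_neg hn.ne', zero_smul] at this

theorem opI_pos_vacuum {n : ℤ} (hn : 0 < n) : opI φ n (mon 0) = 0 := by
  have := rho_vacuum φ (i := .I n) hn.le
  rwa [charVal, if_neg hn.ne', zero_smul] at this

theorem opL_zero_vacuum : opL φ 0 (mon 0) = charVal φ (.L 0) • mon 0 :=
  rho_vacuum φ (i := .L 0) le_rfl

theorem opI_zero_vacuum : opI φ 0 (mon 0) = φ (zeroPartI lam) • mon 0 := by
  have := rho_vacuum φ (i := .I 0) le_rfl
  rwa [charVal, if_pos rfl] at this

theorem rho_negIndex_mon {a : Letter} {K : Multiset Letter} (h : ∀ c ∈ K, a ≤ c) :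
    rho φ (basis lam (negIndex a)) (mon K) = mon (a ::ₘ K) := by
  have := CharInd.rep_inl_single (isChar φ) h
  rwa [triBasis_apply] at this

/-- The vacuum generates the model, and a central element commutes past every letter. -/
theorem rho_central {x : DHV lam} (hx : ∀ y : DHV lam, ⁅x, y⁆ = 0) {c : ℂ}
    (h0 : rho φ x (mon 0) = c • mon 0) (v : Model) : rho φ x v = c • v := by
  induction v using model_induction with
  | hadd u w hu hw => rw [map_add, hu, hw, smul_add]
  | hsmul a u hu => rw [map_smul, hu, smul_comm]
  | hmon K =>
    induction K using mon_induction with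
    | h0 => exact h0
    | hcons a K ha ih =>
      rw [← rho_negIndex_mon φ ha, rho_rho, ih, hx, map_zero, LinearMap.zero_apply, add_zero,
        map_smul]

theorem rho_CL (v : Model) : rho φ (CL lam) v = charVal φ .CL • v :=
  rho_central φ (bracketMap_CL_left lam) (rho_vacuum φ (i := .CL) trivial) v

theorem rho_CLI (v : Model) : rho φ (CLI lam) v = φ (zeroPartCLI lam) • v :=
  rho_central φ (bracketMap_CLI_left lam) (rho_vacuum φ (i := .CLI) trivial) v

theorem opL_opL (m n : ℤ) (v : Model) : opL φ m (opL φ n v) = opL φ n (opL φ m v) +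
    (((n : ℂ) - m) • opL φ (m + n) v +
      ((1 / 12 : ℂ) * ((m : ℂ) ^ 3 - m) * (if m + n = 0 then 1 else 0) * charVal φ .CL) • v) := by
  rw [opL, opL, rho_rho, bracket_def, bracketMap_L_L, map_add, map_smul, map_smul,
    LinearMap.add_apply, LinearMap.smul_apply, LinearMap.smul_apply, rho_CL, smul_smul, opL]

/-- The scalar by which `[L_m, I_n]` acts centrally. -/
def cocycle (m n : ℤ) : ℂ :=
  (1 / 12 : ℂ) * ((m : ℂ) ^ 3 - m) * delta lam 1 * (if m + n = 0 then 1 else 0)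
    * φ (zeroPartCLI lam)

theorem opL_opI (m n : ℤ) (v : Model) : opL φ m (opI φ n v) = opI φ n (opL φ m v) +
    (((n : ℂ) - lam * m) • opI φ (m + n) v + cocycle φ m n • v) := by
  rw [opL, opI, rho_rho, bracket_def, bracketMap_L_I, map_add, map_smul, map_smul,
    LinearMap.add_apply, LinearMap.smul_apply, LinearMap.smul_apply, rho_CLI, smul_smul, opI,
    cocycle]

theorem cocycle_of_ne {m n : ℤ} (h : m + n ≠ 0) : cocycle φ m n = 0 := by simp [cocycle, h]

theorem opI_opI (m n : ℤ) (v : Model) : opI φ m (opI φ n v) = opI φ n (opI φ m v) := by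
  rw [opI, opI, rho_rho, bracket_def, bracketMap_I_I]; simp

theorem opI_opL (m n : ℤ) (v : Model) : opI φ m (opL φ n v) = opL φ n (opI φ m v) -
    (((m : ℂ) - lam * n) • opI φ (n + m) v + cocycle φ n m • v) := by
  rw [opL_opI]; abel

theorem apply_eq_sum (T : Module.End ℂ Model) (v : Model) (S : Multiset Letter) :
    T v S = v.sum fun K c => c * T (mon K) S := by
  induction v using Finsupp.induction_linear with
  | zero => simp
  | add u w hu hw =>
    rw [map_add, Finsupp.add_apply, hu, hw, Finsupp.sum_add_index'] <;> intros <;> ring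
  | single K c =>
    rw [Finsupp.sum_single_index (by simp), ← smul_eq_mul, ← Finsupp.smul_apply, ← map_smul]
    simp

theorem exists_coeff_ne_zero {T : Module.End ℂ Model} {v : Model} {S : Multiset Letter}
    (h : T v S ≠ 0) : ∃ K ∈ v.support, T (mon K) S ≠ 0 := by
  rw [apply_eq_sum] at h
  obtain ⟨K, hK, h⟩ := Finset.exists_ne_zero_of_sum_ne_zero h
  exact ⟨K, hK, right_ne_zero_of_mul h⟩

theorem map_supported_le {T : Module.End ℂ Model} {s t : Set (Multiset Letter)}
    (h : ∀ K ∈ s, T (mon K) ∈ supported ℂ ℂ t) {v : Model} (hv : v ∈ supported ℂ ℂ s) :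
    T v ∈ supported ℂ ℂ t := by
  rw [supported_eq_span_single] at hv
  induction hv using Submodule.span_induction with
  | zero => rw [map_zero]; exact zero_mem _
  | add y y' _ _ hy hy' => rw [map_add]; exact add_mem hy hy'
  | smul c y _ hy => rw [map_smul]; exact Submodule.smul_mem _ _ hy
  | mem y hy => obtain ⟨S, hS, rfl⟩ := hy; exact h S hS

/-! #### Weights -/

/-- The weight of a letter. -/
def letterWt (a : Letter) : ℕ := Sum.elim (· + 1) (· + 1) (ofLex a)

@[simp] theorem letterWt_yy (j : ℕ) : letterWt (yy j) = j + 1 := rfl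
@[simp] theorem letterWt_xx (j : ℕ) : letterWt (xx j) = j + 1 := rfl

theorem letterWt_pos (a : Letter) : 0 < letterWt a := by
  induction a using letter_cases <;> simp

/-- The weight of a monomial. -/
def wt (K : Multiset Letter) : ℕ := (K.map letterWt).sum

@[simp] theorem wt_zero : wt 0 = 0 := rfl
@[simp] theorem wt_cons (a : Letter) (K : Multiset Letter) :
    wt (a ::ₘ K) = letterWt a + wt K := by simp [wt]

theorem wt_eq_zero {K : Multiset Letter} (h : wt K = 0) : K = 0 := by
  induction K using Multiset.induction with
  | empty => rfl
  | cons a K _ =>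
    have := letterWt_pos a
    rw [wt_cons] at h
    omega

theorem opL_zero_mon (K : Multiset Letter) :
    opL φ 0 (mon K) = (charVal φ (.L 0) - (wt K : ℂ)) • mon K := by
  induction K using mon_induction with
  | h0 => rw [opL_zero_vacuum]; simp
  | hcons a K ha ih =>
    induction a using letter_cases with
    | hy j =>
      rw [← opL_mon φ ha, opL_opL, ih, map_smul, opL_mon φ ha, zero_add, opL_mon φ ha]
      push_cast [wt_cons, letterWt_yy]
      module
    | hx j =>
      rw [← opI_mon φ ha, opL_opI, ih, map_smul, opI_mon φ ha, zero_add, opI_mon φ ha,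
        cocycle_of_ne φ (by omega)]
      push_cast [wt_cons, letterWt_xx]
      module

theorem opL_zero_apply (v : Model) (K : Multiset Letter) :
    opL φ 0 v K = (charVal φ (.L 0) - (wt K : ℂ)) * v K := by
  induction v using model_induction with
  | hadd u w hu hw => rw [map_add, Finsupp.add_apply, Finsupp.add_apply, hu, hw, mul_add]
  | hsmul c u hu =>
    rw [map_smul, Finsupp.smul_apply, Finsupp.smul_apply, hu, smul_eq_mul, smul_eq_mul]; ring
  | hmon S =>
    rw [opL_zero_mon, Finsupp.smul_apply, smul_eq_mul]
    by_cases h : S = K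
    · rw [h]
    · rw [Finsupp.single_eq_of_ne (Ne.symm h), mul_zero, mul_zero]

/-- Compare coefficients at `S` in `L_0 L_n = L_n L_0 + n L_n`, where `L_0` is diagonal on
monomials. -/
theorem wt_of_opL {n : ℤ} {K S : Multiset Letter} (h : opL φ n (mon K) S ≠ 0) :
    (wt S : ℤ) = wt K - n := by
  have h1 := congrArg (fun v : Model => v S) (opL_opL φ 0 n (mon K))
  simp only [Finsupp.add_apply, Finsupp.smul_apply, opL_zero_apply, opL_zero_mon, map_smul,
    zero_add, smul_eq_mul] at h1
  have h2 : ((wt S : ℂ) - wt K + n) * opL φ n (mon K) S = 0 := by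
    push_cast at h1
    linear_combination -h1
  have h3 := (mul_eq_zero.1 h2).resolve_right h
  have h4 : ((wt S - wt K + n : ℤ) : ℂ) = 0 := by push_cast; exact h3
  have := Int.cast_eq_zero.1 h4
  omega

theorem wt_of_opI {n : ℤ} {K S : Multiset Letter} (h : opI φ n (mon K) S ≠ 0) :
    (wt S : ℤ) = wt K - n := by
  have h1 := congrArg (fun v : Model => v S) (opL_opI φ 0 n (mon K))
  simp only [Finsupp.add_apply, Finsupp.smul_apply, opL_zero_apply, opL_zero_mon, map_smul,
    zero_add, smul_eq_mul] at h1
  have h0 : cocycle φ 0 n = 0 := by simp [cocycle]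
  rw [h0] at h1
  have h2 : ((wt S : ℂ) - wt K + n) * opI φ n (mon K) S = 0 := by
    push_cast at h1
    linear_combination -h1
  have h3 := (mul_eq_zero.1 h2).resolve_right h
  have h4 : ((wt S - wt K + n : ℤ) : ℂ) = 0 := by push_cast; exact h3
  have := Int.cast_eq_zero.1 h4
  omega

/-! #### Monomials in the letters `I_n` -/

/-- All letters of the monomial are of the form `I_n`. -/
def AllX (K : Multiset Letter) : Prop := ∀ c ∈ K, ∃ j, c = xx j

theorem allX_zero : AllX 0 := fun _ h => absurd h (Multiset.notMem_zero _)

theorem allX_cons {a : Letter} {K : Multiset Letter} :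
    AllX (a ::ₘ K) ↔ (∃ j, a = xx j) ∧ AllX K := by
  simp [AllX]

theorem allX_induction {p : ∀ K, AllX K → Prop} (h0 : p 0 allX_zero)
    (hcons : ∀ j K (hK : AllX K), p K hK → p (xx j ::ₘ K) (allX_cons.2 ⟨⟨j, rfl⟩, hK⟩))
    (K : Multiset Letter) (hK : AllX K) : p K hK := by
  induction K using Multiset.induction with
  | empty => exact h0
  | cons a K ih =>
    obtain ⟨⟨j, rfl⟩, h⟩ := allX_cons.1 hK
    exact hcons j K h (ih h)

theorem xx_le_xx {i j : ℕ} : xx i ≤ xx j ↔ i ≤ j := Sum.Lex.inr_le_inr_iff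
theorem yy_le_yy {i j : ℕ} : yy i ≤ yy j ↔ i ≤ j := Sum.Lex.inl_le_inl_iff
theorem not_xx_le_yy (i j : ℕ) : ¬ xx i ≤ yy j := Sum.Lex.not_inr_le_inl
theorem yy_ne_xx (i j : ℕ) : yy i ≠ xx j := fun h => not_xx_le_yy j i h.ge
theorem xx_injective : Function.Injective xx := fun _ _ h =>
  le_antisymm (xx_le_xx.1 h.le) (xx_le_xx.1 h.ge)
theorem yy_injective : Function.Injective yy := fun _ _ h =>
  le_antisymm (yy_le_yy.1 h.le) (yy_le_yy.1 h.ge)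

theorem allX_of_forall_xx_le {j : ℕ} {K : Multiset Letter} (h : ∀ c ∈ K, xx j ≤ c) : AllX K := by
  intro c hc
  have := h c hc
  induction c using letter_cases with
  | hy i => exact absurd this (not_xx_le_yy j i)
  | hx i => exact ⟨i, rfl⟩

/-- The `I`'s commute, so the ordering condition of `opI_mon` becomes irrelevant. -/
theorem opI_mon_of_allX (j : ℕ) {K : Multiset Letter} (hK : AllX K) :
    opI φ (-(j + 1)) (mon K) = mon (xx j ::ₘ K) := by
  induction K using mon_induction with
  | h0 => exact opI_mon φ (fun c hc => absurd hc (Multiset.notMem_zero c))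
  | hcons a K ha ih =>
    obtain ⟨⟨i, rfl⟩, hK'⟩ := allX_cons.1 hK
    by_cases hji : j ≤ i
    · refine opI_mon φ fun c hc => ?_
      rcases Multiset.mem_cons.1 hc with rfl | hc
      · exact xx_le_xx.2 hji
      · exact (xx_le_xx.2 hji).trans (ha c hc)
    · rw [← opI_mon φ ha, opI_opI, ih hK', opI_mon φ, Multiset.cons_swap]
      intro c hc
      rcases Multiset.mem_cons.1 hc with rfl | hc
      · exact xx_le_xx.2 (by omega)
      · exact ha c hc

theorem opI_pos_of_allX {n : ℤ} (hn : 0 < n) {K : Multiset Letter} (hK : AllX K) :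
    opI φ n (mon K) = 0 := by
  induction K, hK using allX_induction with
  | h0 => exact opI_pos_vacuum φ hn
  | hcons j K hK ih => rw [← opI_mon_of_allX φ j hK, opI_opI, ih, map_zero]

theorem opI_zero_of_allX {K : Multiset Letter} (hK : AllX K) :
    opI φ 0 (mon K) = φ (zeroPartI lam) • mon K := by
  induction K, hK using allX_induction with
  | h0 => exact opI_zero_vacuum φ
  | hcons j K hK ih => rw [← opI_mon_of_allX φ j hK, opI_opI, ih, map_smul]

theorem opI_mem_allX (n : ℤ) {v : Model} (hv : v ∈ supported ℂ ℂ {K | AllX K}) :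
    opI φ n v ∈ supported ℂ ℂ {K | AllX K} := by
  refine map_supported_le (fun K hK => ?_) hv
  rcases lt_trichotomy n 0 with hn | rfl | hn
  · obtain ⟨j, rfl⟩ : ∃ j : ℕ, n = -(j + 1) := ⟨(-n - 1).toNat, by omega⟩
    rw [opI_mon_of_allX φ j hK]
    exact single_mem_supported ℂ _ (allX_cons.2 ⟨⟨j, rfl⟩, hK⟩)
  · rw [opI_zero_of_allX φ hK]
    exact Submodule.smul_mem _ _ (single_mem_supported ℂ _ hK)
  · rw [opI_pos_of_allX φ hn hK]; exact zero_mem _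

theorem opL_pos_mem_allX {n : ℤ} (hn : 0 < n) {v : Model}
    (hv : v ∈ supported ℂ ℂ {K | AllX K}) : opL φ n v ∈ supported ℂ ℂ {K | AllX K} := by
  refine map_supported_le (fun K hK => ?_) hv
  replace hK : AllX K := hK
  induction K, hK using allX_induction with
  | h0 => rw [opL_pos_vacuum φ hn]; exact zero_mem _
  | hcons j K hK ih =>
    have hm : mon K ∈ supported ℂ ℂ {K | AllX K} := single_mem_supported ℂ _ hK
    rw [← opI_mon_of_allX φ j hK, opL_opI]
    exact add_mem (opI_mem_allX φ _ ih) (add_mem (Submodule.smul_mem _ _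
      (opI_mem_allX φ _ hm)) (Submodule.smul_mem _ _ hm))

theorem opI_pos_eq_zero {n : ℤ} (hn : 0 < n) {v : Model}
    (hv : v ∈ supported ℂ ℂ {K | AllX K}) : opI φ n v = 0 := by
  have : opI φ n v ∈ supported ℂ ℂ (∅ : Set (Multiset Letter)) :=
    map_supported_le (fun K hK => by rw [opI_pos_of_allX φ hn hK]; exact zero_mem _) hv
  simpa using this

/-- The derivative of a monomial with respect to a letter. -/
def dmon (a : Letter) (K : Multiset Letter) : Model := (K.count a : ℂ) • mon (K.erase a)

/-- The Leibniz rule for the formal derivative, when `T` acts as multiplication by `c` on the erased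
monomial. -/
theorem dmon_cons {T : Module.End ℂ Model} {a c : Letter} {K : Multiset Letter}
    (hT : T (mon (K.erase a)) = mon (c ::ₘ K.erase a)) :
    dmon a (c ::ₘ K) = T (dmon a K) + if c = a then mon K else 0 := by
  rw [dmon, dmon, map_smul, hT]
  by_cases h : c = a
  · subst h
    rw [Multiset.count_cons_self, Multiset.erase_cons_head, if_pos rfl]
    by_cases hc : c ∈ K
    · rw [Multiset.cons_erase hc]; push_cast; module
    · rw [Multiset.count_eq_zero_of_notMem hc]; simp
  · rw [Multiset.count_cons_of_ne (Ne.symm h), Multiset.erase_cons_tail _ h, if_neg h,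
      add_zero]

/-- The value of `φ` on `[L_m, I_{-m}]` for `m = n + 1`. -/
def pairing (n : ℕ) : ℂ :=
  (-((n : ℂ) + 1) - lam * (n + 1)) * φ (zeroPartI lam) + cocycle φ (n + 1) (-(n + 1))

/-- Commuting `L_{n+1}` past `I_{-(j+1)}` yields a multiple of `I_{n-j}`, which kills `I`-monomials
if `j < n`; for `j = n` it yields the scalar `pairing φ n`. So `L_{n+1}` acts as a derivation. -/
theorem opL_top_of_allX (n : ℕ) {K : Multiset Letter} (hK : AllX K)
    (hn : ∀ c ∈ K, c ≤ xx n) : opL φ (n + 1) (mon K) = pairing φ n • dmon (xx n) K := by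
  induction K, hK using allX_induction with
  | h0 => rw [opL_pos_vacuum φ (by omega)]; simp [dmon]
  | hcons j K hK ih =>
    have hj : j ≤ n := xx_le_xx.1 (hn _ (Multiset.mem_cons_self _ _))
    have hKe : AllX (K.erase (xx n)) := fun c hc => hK c (Multiset.mem_of_mem_erase hc)
    rw [dmon_cons (opI_mon_of_allX φ j hKe), ← opI_mon_of_allX φ j hK, opL_opI,
      ih fun c hc => hn c (Multiset.mem_cons_of_mem hc), map_smul, smul_add]
    congr 1
    by_cases hjn : j = n
    · subst hjn
      rw [if_pos rfl, add_neg_cancel, opI_zero_of_allX φ hK, pairing]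
      push_cast
      module
    · rw [if_neg fun h => hjn (xx_injective h), opI_pos_of_allX φ (by omega) hK,
        cocycle_of_ne φ (by omega)]
      simp

/-! #### The filtration by the number of letters `L_n` -/

/-- The number of letters `L_n` in a monomial. -/
def numL (K : Multiset Letter) : ℕ := CharInd.deg (fun k => lDeg (splitIndex k)) K

@[simp] theorem numL_zero : numL 0 = 0 := rfl
@[simp] theorem numL_cons_yy (j : ℕ) (K : Multiset Letter) :
    numL (yy j ::ₘ K) = 1 + numL K := by
  rw [numL, CharInd.deg_cons]; rfl
@[simp] theorem numL_cons_xx (j : ℕ) (K : Multiset Letter) :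
    numL (xx j ::ₘ K) = numL K := by
  rw [numL, CharInd.deg_cons]; exact zero_add _

theorem allX_iff_numL {K : Multiset Letter} : AllX K ↔ numL K = 0 := by
  induction K using Multiset.induction with
  | empty => simp [allX_zero]
  | cons a K ih =>
    rw [allX_cons, ih]
    induction a using letter_cases with
    | hy j =>
      rw [numL_cons_yy]
      exact ⟨fun ⟨⟨i, h⟩, _⟩ => absurd h (yy_ne_xx j i), fun h => by omega⟩
    | hx j => rw [numL_cons_xx]; exact ⟨fun h => h.2, fun h => ⟨⟨j, rfl⟩, h⟩⟩

theorem rho_mon_mem (i : DHVIndex) (K : Multiset Letter) :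
    rho φ (basis lam i) (mon K) ∈ supported ℂ ℂ {S | numL S ≤ lDeg i + numL K} := by
  obtain ⟨k, rfl⟩ := splitIndex_bijective.2 i
  have := CharInd.rep_single_mem (isChar φ) (fun k => lDeg (splitIndex k)) (fun i j k h => by
    rw [triBasis_repr, triBasis_apply, triBasis_apply, bracket_def, bracketMap_basis] at h
    exact lDeg_le lam _ _ _ h) k K
  rwa [triBasis_apply] at this

/-- The span of the monomials with less than `s` letters `L_n`. -/
abbrev filL (s : ℕ) : Submodule ℂ Model := supported ℂ ℂ {S | numL S < s}

theorem mon_mem_filL {K : Multiset Letter} {s : ℕ} (h : numL K < s) : mon K ∈ filL s :=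
  single_mem_supported ℂ _ h

theorem opI_mem_filL (n : ℤ) {s : ℕ} {v : Model} (hv : v ∈ filL s) : opI φ n v ∈ filL s :=
  map_supported_le (fun K hK => supported_mono (fun S hS => by
    have h1 : numL S ≤ 0 + numL K := hS
    have h2 : numL K < s := hK
    change numL S < s
    omega) (rho_mon_mem φ (.I n) K)) hv

theorem opL_mem_filL (n : ℤ) {s : ℕ} {v : Model} (hv : v ∈ filL s) : opL φ n v ∈ filL (s + 1) :=
  map_supported_le (fun K hK => supported_mono (fun S hS => by
    have h1 : numL S ≤ 1 + numL K := hS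
    have h2 : numL K < s := hK
    change numL S < s + 1
    omega) (rho_mon_mem φ (.L n) K)) hv

theorem eq_zero_of_mem_filL_zero {v : Model} (hv : v ∈ filL 0) : v = 0 := by
  have : {S | numL S < 0} = (∅ : Set (Multiset Letter)) := by ext; simp
  rw [filL, this] at hv
  simpa using hv

/-- Positive `I`'s kill `I`-monomials, so a nonzero result must consume at least one letter `L` in a
commutator. -/
theorem opI_pos_mem_filL {n : ℤ} (hn : 0 < n) (K : Multiset Letter) :
    opI φ n (mon K) ∈ filL (numL K) := by
  induction K using mon_induction with
  | h0 => rw [opI_pos_vacuum φ hn]; exact zero_mem _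
  | hcons a K ha ih =>
    induction a using letter_cases with
    | hx j =>
      rw [← opI_mon φ ha, opI_opI, numL_cons_xx]
      exact opI_mem_filL φ _ ih
    | hy j =>
      have hm : mon K ∈ filL (numL K + 1) := mon_mem_filL (Nat.lt_succ_self _)
      rw [← opL_mon φ ha, opI_opL, numL_cons_yy, add_comm 1]
      exact sub_mem (opL_mem_filL φ _ ih) (add_mem (Submodule.smul_mem _ _
        (opI_mem_filL φ _ hm)) (Submodule.smul_mem _ _ hm))

theorem opI_zero_mem_filL (K : Multiset Letter) :
    opI φ 0 (mon K) - φ (zeroPartI lam) • mon K ∈ filL (numL K) := by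
  induction K using mon_induction with
  | h0 => rw [opI_zero_vacuum, sub_self]; exact zero_mem _
  | hcons a K ha ih =>
    induction a using letter_cases with
    | hx j =>
      rw [← opI_mon φ ha, opI_opI, numL_cons_xx, ← map_smul, ← map_sub]
      exact opI_mem_filL φ _ ih
    | hy j =>
      have hm : mon K ∈ filL (numL K + 1) := mon_mem_filL (Nat.lt_succ_self _)
      rw [← opL_mon φ ha, opI_opL, numL_cons_yy, add_comm 1, sub_right_comm, ← map_smul,
        ← map_sub]
      exact sub_mem (opL_mem_filL φ _ ih) (add_mem (Submodule.smul_mem _ _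
        (opI_mem_filL φ _ hm)) (Submodule.smul_mem _ _ hm))

/-- The cocycle is odd in its first index, so `[I_m, L_{-m}]` and `[L_m, I_{-m}]` give the same
scalar. -/
theorem pairing_eq (n : ℕ) : pairing φ n = -((((n : ℂ) + 1) + lam * (n + 1)) * φ (zeroPartI lam)
    + cocycle φ (-(n + 1)) (n + 1)) := by
  rw [pairing, cocycle, cocycle, add_neg_cancel, neg_add_cancel]
  push_cast
  ring

/-- The dual of `opL_top_of_allX`: commuting `I_{n+1}` past `L_{-(n+1)}` gives the pairing to
leading order, while passing `L_{-(j+1)}` with `j < n` leaves a positive `I`, which costs a further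
letter `L`. -/
theorem opI_top_mem_filL (n : ℕ) (K : Multiset Letter) (hn : ∀ j, yy j ∈ K → j ≤ n) :
    opI φ (n + 1) (mon K) - pairing φ n • dmon (yy n) K ∈ filL (numL K - 1) := by
  induction K using mon_induction with
  | h0 => rw [opI_pos_vacuum φ (by omega)]; simp [dmon]
  | hcons a K ha ih =>
    induction a using letter_cases with
    | hx j =>
      have hA : AllX (xx j ::ₘ K) := allX_cons.2 ⟨⟨j, rfl⟩, allX_of_forall_xx_le ha⟩
      have hy : yy n ∉ xx j ::ₘ K := fun h => by
        obtain ⟨i, hi⟩ := hA _ h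
        exact yy_ne_xx _ _ hi
      rw [opI_pos_of_allX φ (by omega) hA, dmon, Multiset.count_eq_zero_of_notMem hy]
      simp
    | hy j =>
      have hj : j ≤ n := hn _ (Multiset.mem_cons_self _ _)
      have ih' := ih fun j hj => hn j (Multiset.mem_cons_of_mem hj)
      have h1 : opL φ (-(j + 1)) (opI φ (n + 1) (mon K) - pairing φ n • dmon (yy n) K) ∈
          filL (numL K) := by
        rcases Nat.eq_zero_or_pos (numL K) with h0 | h0
        · rw [h0] at ih' ⊢
          rw [eq_zero_of_mem_filL_zero ih', map_zero]
          exact zero_mem _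
        · have := opL_mem_filL φ (-(j + 1)) ih'
          rwa [Nat.sub_add_cancel h0] at this
      rw [numL_cons_yy, Nat.add_sub_cancel_left, dmon_cons (opL_mon φ fun c hc =>
        ha c (Multiset.mem_of_mem_erase hc)), ← opL_mon φ ha, opI_opL]
      by_cases hjn : j = n
      · subst hjn
        have h2 := Submodule.smul_mem _ ((j : ℂ) + 1 + lam * (j + 1)) (opI_zero_mem_filL φ K)
        convert sub_mem h1 h2 using 1
        rw [if_pos rfl, neg_add_cancel, map_sub, map_smul, pairing_eq]
        push_cast
        module
      · have h2 := Submodule.smul_mem _ ((n : ℂ) + 1 + lam * (j + 1))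
          (opI_pos_mem_filL φ (n := -(j + 1) + (n + 1)) (by omega) K)
        convert sub_mem h1 h2 using 1
        rw [if_neg fun h => hjn (yy_injective h), map_sub, map_smul, cocycle_of_ne φ (by omega)]
        push_cast
        module

/-! #### Singular vectors -/

theorem letterWt_le_wt {a : Letter} {K : Multiset Letter} (h : a ∈ K) : letterWt a ≤ wt K :=
  Multiset.le_sum_of_mem (Multiset.mem_map_of_mem _ h)

theorem numL_erase_yy {n : ℕ} {K : Multiset Letter} (h : yy n ∈ K) :
    1 + numL (K.erase (yy n)) = numL K := by
  rw [← numL_cons_yy n, Multiset.cons_erase h]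

theorem dmon_apply_erase {a : Letter} {K K' : Multiset Letter} (ha : a ∈ K') (h : K ≠ K') :
    dmon a K (K'.erase a) = 0 := by
  rw [dmon, Finsupp.smul_apply]
  by_cases hK : a ∈ K
  · rw [Finsupp.single_eq_of_ne, smul_zero]
    intro e
    exact h (by rw [← Multiset.cons_erase hK, ← Multiset.cons_erase ha, e])
  · rw [Multiset.count_eq_zero_of_notMem hK]; simp

theorem dmon_apply_erase_self {a : Letter} {K : Multiset Letter} (ha : a ∈ K) :
    dmon a K (K.erase a) ≠ 0 := by
  rw [dmon, Finsupp.smul_apply, Finsupp.single_eq_same, smul_eq_mul, mul_one, Nat.cast_ne_zero]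
  exact (Multiset.count_pos.2 ha).ne'

theorem exists_max_letter (f : ℕ → Letter) (hf : ∀ j, letterWt (f j) = j + 1) (v : Model)
    (p : Multiset Letter → Prop) (h : ∃ K ∈ v.support, p K ∧ ∃ j, f j ∈ K) :
    ∃ n, ∃ K ∈ v.support, p K ∧ f n ∈ K ∧
      ∀ S ∈ v.support, p S → ∀ j, f j ∈ S → j ≤ n := by
  let s : Set ℕ := {n | ∃ K ∈ v.support, p K ∧ f n ∈ K}
  have hne : s.Nonempty := by
    obtain ⟨K, hK, hp, j, hj⟩ := h
    exact ⟨j, K, hK, hp, hj⟩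
  have hb : BddAbove s := by
    refine ⟨∑ K ∈ v.support, wt K, ?_⟩
    rintro n ⟨K, hK, -, hn⟩
    have h1 := letterWt_le_wt hn
    have h2 := Finset.single_le_sum (f := wt) (fun _ _ => Nat.zero_le _) hK
    rw [hf] at h1
    omega
  obtain ⟨K, hK, hp, hn⟩ := Nat.sSup_mem hne hb
  exact ⟨sSup s, K, hK, hp, hn, fun S hS hpS j hj => le_csSup hb ⟨S, hS, hpS, hj⟩⟩

/-- Let `r` be the maximal number of letters `L` in `v`, and `n` the largest index of such a letter
among monomials attaining `r`, say in `K0`. Only `K0` contributes to the coefficient of `I_{n+1} v`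
at `K0.erase (yy n)`: monomials with fewer `L`'s land too low, and the others differ after
differentiation. -/
theorem exists_opI_ne_zero (hc : ∀ n, pairing φ n ≠ 0) {v : Model}
    (hv : ∃ K ∈ v.support, ¬ AllX K) : ∃ n : ℕ, opI φ (n + 1) v ≠ 0 := by
  obtain ⟨K, hK, hKx⟩ := hv
  obtain ⟨K1, hK1, hmax⟩ := Finset.exists_max_image v.support numL ⟨K, hK⟩
  have hpos : 0 < numL K1 :=
    (Nat.pos_of_ne_zero (mt allX_iff_numL.2 hKx)).trans_le (hmax K hK)
  have hy : ∃ j, yy j ∈ K1 := by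
    have h1 : ¬ AllX K1 := mt allX_iff_numL.1 hpos.ne'
    simp only [AllX, not_forall] at h1
    obtain ⟨c, hc, hcx⟩ := h1
    induction c using letter_cases with
    | hy j => exact ⟨j, hc⟩
    | hx j => exact absurd ⟨j, rfl⟩ hcx
  obtain ⟨n, K0, hK0, hr, hn, hle⟩ := exists_max_letter yy (fun _ => rfl) v
    (fun K => numL K = numL K1) ⟨K1, hK1, rfl, hy⟩
  have her := numL_erase_yy hn
  refine ⟨n, fun h0 => ?_⟩
  have h1 := apply_eq_sum (opI φ (n + 1)) v (K0.erase (yy n))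
  rw [h0, Finsupp.sum, Finset.sum_eq_single_of_mem K0 hK0] at h1
  · have h2 := (mem_supported' ℂ _).1 (opI_top_mem_filL φ n K0 (hle K0 hK0 hr))
      (K0.erase (yy n)) (fun h => by
        have h' : numL (K0.erase (yy n)) < numL K0 - 1 := h
        omega)
    rw [Finsupp.sub_apply, sub_eq_zero] at h2
    rw [h2, Finsupp.smul_apply, smul_eq_mul] at h1
    exact mul_ne_zero (Finsupp.mem_support_iff.1 hK0)
      (mul_ne_zero (hc n) (dmon_apply_erase_self hn)) h1.symm
  · intro S hS hne
    refine mul_eq_zero_of_right _ ?_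
    rcases (hmax S hS).lt_or_eq with hlt | heq
    · refine (mem_supported' ℂ _).1 (opI_pos_mem_filL φ (n := n + 1) (by omega) S) _ fun h => ?_
      have h' : numL (K0.erase (yy n)) < numL S := h
      omega
    · have h2 := (mem_supported' ℂ _).1 (opI_top_mem_filL φ n S (hle S hS heq))
        (K0.erase (yy n)) (fun h => by
          have h' : numL (K0.erase (yy n)) < numL S - 1 := h
          omega)
      rw [Finsupp.sub_apply, sub_eq_zero] at h2
      rw [h2, Finsupp.smul_apply, dmon_apply_erase hn hne, smul_zero]

/-- For the largest index `n` in `v`, `L_{n+1}` is a nonzero multiple of a derivative, and distinct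
monomials containing a letter stay distinct once it is erased. -/
theorem exists_opL_ne_zero (hc : ∀ n, pairing φ n ≠ 0) {v : Model}
    (hx : ∀ K ∈ v.support, AllX K) (hv : ∃ K ∈ v.support, K ≠ 0) :
    ∃ n : ℕ, opL φ (n + 1) v ≠ 0 := by
  obtain ⟨K, hK, hne⟩ := hv
  have hex : ∃ j, xx j ∈ K := by
    obtain ⟨c, hcK⟩ := Multiset.exists_mem_of_ne_zero hne
    obtain ⟨j, rfl⟩ := hx K hK c hcK
    exact ⟨j, hcK⟩
  obtain ⟨n, K0, hK0, -, hn, hle⟩ := exists_max_letter xx (fun _ => rfl) v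
    (fun _ => True) ⟨K, hK, trivial, hex⟩
  have hle' : ∀ S ∈ v.support, ∀ c ∈ S, c ≤ xx n := fun S hS c hcS => by
    obtain ⟨j, rfl⟩ := hx S hS c hcS
    exact xx_le_xx.2 (hle S hS trivial j hcS)
  refine ⟨n, fun h0 => ?_⟩
  have h1 := apply_eq_sum (opL φ (n + 1)) v (K0.erase (xx n))
  rw [h0, Finsupp.sum, Finset.sum_eq_single_of_mem K0 hK0] at h1
  · rw [opL_top_of_allX φ n (hx K0 hK0) (hle' K0 hK0), Finsupp.smul_apply, smul_eq_mul] at h1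
    exact mul_ne_zero (Finsupp.mem_support_iff.1 hK0)
      (mul_ne_zero (hc n) (dmon_apply_erase_self hn)) h1.symm
  · intro S hS hne
    rw [opL_top_of_allX φ n (hx S hS) (hle' S hS), Finsupp.smul_apply, dmon_apply_erase hn hne,
      smul_zero, mul_zero]

/-- If no pairing vanishes, every nonzero submodule of the model contains the vacuum. -/
theorem vacuum_mem_of_pairing_ne_zero (hc : ∀ n, pairing φ n ≠ 0) {W : Submodule ℂ Model}
    (hW : ∀ x, ∀ v ∈ W, rho φ x v ∈ W) {v : Model} (hvW : v ∈ W) (hv : v ≠ 0) :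
    mon 0 ∈ W := by
  -- Induction on a strict bound for the weights in `v`, since `v` need not be homogeneous.
  suffices h : ∀ (N : ℕ) (v : Model), (∀ K, v K ≠ 0 → wt K < N) → v ∈ W → v ≠ 0 → mon 0 ∈ W by
    refine h (∑ K ∈ v.support, wt K + 1) v (fun K hK => ?_) hvW hv
    exact Nat.lt_succ_of_le (Finset.single_le_sum (f := wt) (fun _ _ => Nat.zero_le _)
      (Finsupp.mem_support_iff.2 hK))
  clear hvW hv v
  intro N
  induction N with
  | zero =>
    intro v hN _ hv
    obtain ⟨K, hK⟩ := Finsupp.ne_iff.1 hv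
    exact absurd (hN K hK) (Nat.not_lt_zero _)
  | succ N ih =>
    intro v hN hvW hv
    by_cases h0 : ∃ K ∈ v.support, K ≠ 0
    · by_cases hx : ∀ K ∈ v.support, AllX K
      · obtain ⟨n, hn⟩ := exists_opL_ne_zero φ hc hx h0
        refine ih _ (fun S hS => ?_) (hW _ v hvW) hn
        obtain ⟨K, hK, hKS⟩ := exists_coeff_ne_zero (T := opL φ (n + 1)) hS
        have h1 := wt_of_opL φ hKS
        have h2 := hN K (Finsupp.mem_support_iff.1 hK)
        omega
      · push Not at hx
        obtain ⟨n, hn⟩ := exists_opI_ne_zero φ hc hx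
        refine ih _ (fun S hS => ?_) (hW _ v hvW) hn
        obtain ⟨K, hK, hKS⟩ := exists_coeff_ne_zero (T := opI φ (n + 1)) hS
        have h1 := wt_of_opI φ hKS
        have h2 := hN K (Finsupp.mem_support_iff.1 hK)
        omega
    · push Not at h0
      have hv0 : v = v 0 • mon 0 := by
        ext K
        by_cases hK : K = 0
        · subst hK; simp
        · have : v K = 0 := by
            by_contra h
            exact hK (h0 K (Finsupp.mem_support_iff.2 h))
          rw [this, Finsupp.smul_apply, Finsupp.single_eq_of_ne hK, smul_zero]
      have hne : v 0 ≠ 0 := fun h => hv (by rw [hv0, h, zero_smul])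
      rw [hv0] at hvW
      exact (Submodule.smul_mem_iff _ hne).1 hvW

/-! #### The submodule of vectors not reaching the vacuum -/

/-- The basis vectors `L_n`, `I_n` with `n > 0`. -/
def IsPos (x : DHV lam) : Prop := ∃ n : ℤ, 0 < n ∧ (x = L lam n ∨ x = I lam n)

/-- The action of a product of elements of `𝔤`. -/
def opW (l : List (DHV lam)) : Module.End ℂ Model := (l.map (rho φ)).prod

theorem opW_cons (x : DHV lam) (l : List (DHV lam)) (v : Model) :
    opW φ (x :: l) v = rho φ x (opW φ l v) := by simp [opW]

theorem opW_concat (x : DHV lam) (l : List (DHV lam)) (v : Model) :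
    opW φ (l ++ [x]) v = opW φ l (rho φ x v) := by simp [opW]

/-- The vectors which no product of elements of positive degree maps to a vector with nonzero
vacuum component. -/
def radical : Submodule ℂ Model where
  carrier := {y | ∀ l : List (DHV lam), (∀ x ∈ l, IsPos x) → opW φ l y 0 = 0}
  zero_mem' l _ := by simp
  add_mem' hu hv l hl := by rw [map_add, Finsupp.add_apply, hu l hl, hv l hl, add_zero]
  smul_mem' c u hu l hl := by rw [map_smul, Finsupp.smul_apply, hu l hl, smul_zero]

/-- Negative degree raises weights, so the vacuum is never reached; degree zero preserves weights;
positive degree is covered by words of length one. -/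
theorem rho_apply_zero {y : Model} (hy : y ∈ radical φ) (x : DHV lam) : rho φ x y 0 = 0 := by
  have h0 : y 0 = 0 := by simpa [opW] using hy [] (by simp)
  have hpos : ∀ x : DHV lam, IsPos x → rho φ x y 0 = 0 := fun x hx => by
    simpa [opW] using hy [x] (by simpa using hx)
  induction x using basis_induction with
  | hadd x x' hx hx' => rw [map_add, LinearMap.add_apply, Finsupp.add_apply, hx, hx', add_zero]
  | hsmul c x hx => rw [map_smul, LinearMap.smul_apply, Finsupp.smul_apply, hx, smul_zero]
  | hb i =>
    cases i with
    | CL => rw [basis_CL, rho_CL, Finsupp.smul_apply, h0, smul_zero]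
    | CLI => rw [basis_CLI, rho_CLI, Finsupp.smul_apply, h0, smul_zero]
    | L n =>
      rcases lt_trichotomy n 0 with hn | rfl | hn
      · by_contra h
        obtain ⟨K, -, hK⟩ := exists_coeff_ne_zero (T := opL φ n) h
        have := wt_of_opL φ hK
        rw [wt_zero] at this
        omega
      · exact (opL_zero_apply φ y 0).trans (by rw [h0, mul_zero])
      · exact hpos _ ⟨n, hn, .inl rfl⟩
    | I n =>
      rcases lt_trichotomy n 0 with hn | rfl | hn
      · by_contra h
        obtain ⟨K, -, hK⟩ := exists_coeff_ne_zero (T := opI φ n) h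
        have := wt_of_opI φ hK
        rw [wt_zero] at this
        omega
      · by_contra h
        obtain ⟨K, hKy, hK⟩ := exists_coeff_ne_zero (T := opI φ 0) h
        have := wt_of_opI φ hK
        rw [wt_zero] at this
        obtain rfl : K = 0 := wt_eq_zero (by omega)
        exact Finsupp.mem_support_iff.1 hKy h0
      · exact hpos _ ⟨n, hn, .inr rfl⟩

/-- Commute `x` past the rightmost letter `m` of the word: both `m * y` with `x`, and `y` with `[m,
x]`, are tested against a shorter word. This is why `x` must be arbitrary in the induction. -/
theorem rho_mem_radical (x : DHV lam) {y : Model} (hy : y ∈ radical φ) :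
    rho φ x y ∈ radical φ := by
  intro l hl
  induction l using List.reverseRecOn generalizing x y with
  | nil => exact rho_apply_zero φ hy x
  | append_singleton l m ih =>
    have hm : IsPos m := hl m (by simp)
    have hl' : ∀ x ∈ l, IsPos x := fun x hx => hl x (by simp [hx])
    have hmy : rho φ m y ∈ radical φ := fun l' h' => by
      rw [← opW_concat]
      refine hy _ fun z hz => ?_
      rcases List.mem_append.1 hz with hz | hz
      · exact h' z hz
      · rwa [List.mem_singleton.1 hz]
    rw [opW_concat, rho_rho, map_add, Finsupp.add_apply, ih x hmy hl', ih _ hy hl', add_zero]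

theorem vacuum_notMem_radical : mon 0 ∉ radical φ := fun h => by
  simpa [opW] using h [] (by simp)

/-! #### A vector of the radical -/

/-- The action of a product of the `L_m` for `m` in a list. -/
def wordL (l : List ℕ) : Module.End ℂ Model := (l.map fun m : ℕ => opL φ m).prod

theorem wordL_cons (m : ℕ) (l : List ℕ) (v : Model) :
    wordL φ (m :: l) v = opL φ m (wordL φ l v) := by simp [wordL]

theorem wordL_append (l l' : List ℕ) (v : Model) :
    wordL φ (l ++ l') v = wordL φ l (wordL φ l' v) := by simp [wordL]

theorem wordL_mem_allX {l : List ℕ} (hl : ∀ m ∈ l, 0 < m) {v : Model}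
    (hv : v ∈ supported ℂ ℂ {K | AllX K}) : wordL φ l v ∈ supported ℂ ℂ {K | AllX K} := by
  induction l with
  | nil => exact hv
  | cons m l ih =>
    rw [wordL_cons]
    exact opL_pos_mem_allX φ (by exact_mod_cast hl m (by simp))
      (ih fun m hm => hl m (by simp [hm]))

theorem wt_of_wordL {v : Model} {c : ℤ} (hv : ∀ S, v S ≠ 0 → (wt S : ℤ) = c) (l : List ℕ)
    (S : Multiset Letter) (h : wordL φ l v S ≠ 0) : (wt S : ℤ) = c - l.sum := by
  induction l generalizing S with
  | nil => simpa using hv S h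
  | cons m l ih =>
    rw [wordL_cons] at h
    obtain ⟨K, hK, hKS⟩ := exists_coeff_ne_zero h
    have h1 := wt_of_opL φ hKS
    have h2 := ih K (Finsupp.mem_support_iff.1 hK)
    rw [List.sum_cons, Nat.cast_add]
    omega

/-- Swapping neighbours costs a multiple of `L_{x+y}`: a word with the same sum but one letter
fewer, which is assumed to have no vacuum component. -/
theorem wordL_perm {w : Model} {k r : ℕ}
    (hw : ∀ l : List ℕ, (∀ m ∈ l, 0 < m) → l.sum = k → l.length < r → wordL φ l w 0 = 0)
    {l l' : List ℕ} (hp : l.Perm l') (p : List ℕ) (hpos : ∀ m ∈ p ++ l, 0 < m)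
    (hsum : (p ++ l).sum = k) (hlen : (p ++ l).length ≤ r) :
    wordL φ (p ++ l) w 0 = wordL φ (p ++ l') w 0 := by
  induction hp generalizing p with
  | nil => rfl
  | cons x h ih =>
    have := ih (p ++ [x]) (by simpa using hpos) (by simpa using hsum) (by simpa using hlen)
    simpa using this
  | trans h h' ih ih' =>
    rw [ih p hpos hsum hlen]
    have hh := h.append_left p
    exact ih' p (fun m hm => hpos m (hh.mem_iff.2 hm)) (by rw [← hh.sum_eq, hsum])
      (by rwa [← hh.length_eq])
  | swap x y l =>
    have hx : 0 < x := hpos x (by simp)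
    have h0 : wordL φ (p ++ (y + x) :: l) w 0 = 0 := by
      refine hw _ (fun m hm => ?_) ?_ ?_
      · simp only [List.mem_append, List.mem_cons] at hm
        rcases hm with hm | rfl | hm
        · exact hpos m (by simp [hm])
        · omega
        · exact hpos m (by simp [hm])
      · simp only [List.sum_append, List.sum_cons] at hsum ⊢; omega
      · simp only [List.length_append, List.length_cons] at hlen ⊢; omega
    rw [wordL_append, wordL_cons] at h0
    rw [wordL_append, wordL_append, wordL_cons, wordL_cons, wordL_cons, wordL_cons, opL_opL,
      if_neg (by omega)]
    push_cast at h0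
    simp [h0]

/-- Weights exclude words whose sum is not `k`; the others are sorted into partitions, by induction
on length. -/
theorem wordL_eq_zero {w : Model} {k : ℕ} (hk : ∀ S, w S ≠ 0 → wt S = k)
    (hw : ∀ μ : Nat.Partition k, wordL φ (μ.parts.sort (· ≤ ·)) w 0 = 0)
    (l : List ℕ) (hl : ∀ m ∈ l, 0 < m) : wordL φ l w 0 = 0 := by
  by_cases hsum : l.sum = k
  · induction hr : l.length using Nat.strong_induction_on generalizing l with
    | _ r ih =>
      let μ : Nat.Partition k := ⟨(l : Multiset ℕ), fun {i} hi => hl i (by simpa using hi),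
        by simpa using hsum⟩
      have hp : l.Perm (μ.parts.sort (· ≤ ·)) :=
        Multiset.coe_eq_coe.1 (Multiset.sort_eq _ _).symm
      rw [← hw μ]
      exact wordL_perm φ (fun l hl hsum hlen => ih _ hlen l hl hsum rfl) hp [] hl hsum hr.le
  · by_contra h
    have h1 := wt_of_wordL φ (c := k) (fun S hS => by rw [hk S hS]) l 0 h
    rw [wt_zero] at h1
    omega

theorem opW_eq_wordL {w : Model} (hw : w ∈ supported ℂ ℂ {K | AllX K}) (l : List (DHV lam))
    (hl : ∀ x ∈ l, IsPos x) :
    opW φ l w = 0 ∨ ∃ l' : List ℕ, (∀ m ∈ l', 0 < m) ∧ opW φ l w = wordL φ l' w := by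
  induction l with
  | nil => exact .inr ⟨[], by simp, rfl⟩
  | cons x l ih =>
    rw [opW_cons]
    rcases ih fun x hx => hl x (by simp [hx]) with h | ⟨l', hl', h⟩
    · left; rw [h, map_zero]
    · obtain ⟨n, hn, rfl | rfl⟩ := hl x (by simp)
      · refine .inr ⟨n.toNat :: l', fun m hm => ?_, ?_⟩
        · rcases List.mem_cons.1 hm with rfl | hm
          · omega
          · exact hl' m hm
        · rw [wordL_cons, h, Int.toNat_of_nonneg hn.le, opL]
      · left
        rw [h]
        exact opI_pos_eq_zero φ hn (wordL_mem_allX φ hl' hw)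

/-- The monomial in the letters `I_{-m}` attached to a partition. -/
def partMon {k : ℕ} (μ : Nat.Partition k) : Multiset Letter := μ.parts.map fun m => xx (m - 1)

theorem map_letterWt_partMon {k : ℕ} (μ : Nat.Partition k) :
    (partMon μ).map letterWt = μ.parts := by
  rw [partMon, Multiset.map_map]
  conv_rhs => rw [← Multiset.map_id μ.parts]
  refine Multiset.map_congr rfl fun m hm => ?_
  have := μ.parts_pos hm
  simp only [Function.comp_apply, letterWt_xx, id]
  omega

theorem partMon_injective (k : ℕ) : Function.Injective (partMon (k := k)) := fun μ ν h =>
  Nat.Partition.ext (by rw [← map_letterWt_partMon, h, map_letterWt_partMon])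

theorem wt_partMon {k : ℕ} (μ : Nat.Partition k) : wt (partMon μ) = k := by
  rw [wt, map_letterWt_partMon, μ.parts_sum]

theorem allX_partMon {k : ℕ} (μ : Nat.Partition k) : AllX (partMon μ) := fun c hc => by
  obtain ⟨m, -, rfl⟩ := Multiset.mem_map.1 hc
  exact ⟨_, rfl⟩

/-- If a pairing vanishes, the radical is nonzero. -/
theorem radical_ne_bot {n : ℕ} (hn : pairing φ n = 0) : radical φ ≠ ⊥ := by
  let comb : (Nat.Partition (n + 1) → ℂ) →ₗ[ℂ] Model :=
    Fintype.linearCombination ℂ fun ν => mon (partMon ν)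
  have comb_eq : ∀ f, comb f = ∑ ν, f ν • mon (partMon ν) := fun f => rfl
  have comb_apply : ∀ f ν, comb f (partMon ν) = f ν := fun f ν => by
    rw [comb_eq, Finsupp.finsetSum_apply, Finset.sum_eq_single ν]
    · simp
    · intro μ _ h
      rw [Finsupp.smul_apply, Finsupp.single_eq_of_ne fun e => h (partMon_injective _ e.symm),
        smul_zero]
    · simp
  have comb_supp : ∀ f S, comb f S ≠ 0 → ∃ ν : Nat.Partition (n + 1), S = partMon ν := by
    intro f S h
    rw [comb_eq, Finsupp.finsetSum_apply] at h
    obtain ⟨ν, -, h⟩ := Finset.exists_ne_zero_of_sum_ne_zero h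
    refine ⟨ν, ?_⟩
    by_contra hne
    exact h (by rw [Finsupp.smul_apply, Finsupp.single_eq_of_ne hne, smul_zero])
  -- A monomial of weight `n + 1` has no letter beyond `xx n`, so `L_{n+1}` acts through the
  -- vanishing pairing.
  have hker : ∀ f, opL φ (n + 1) (comb f) = 0 := fun f => by
    rw [comb_eq, map_sum]
    refine Finset.sum_eq_zero fun ν _ => ?_
    rw [map_smul, opL_top_of_allX φ n (allX_partMon ν), hn, zero_smul, smul_zero]
    intro c hc
    obtain ⟨j, rfl⟩ := allX_partMon ν c hc
    have := letterWt_le_wt hc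
    rw [wt_partMon, letterWt_xx] at this
    exact xx_le_xx.2 (by omega)
  -- Rows and columns are both indexed by partitions of `n + 1`. The row of the one-part partition
  -- vanishes, so the map is not surjective and therefore not injective.
  let Θ : (Nat.Partition (n + 1) → ℂ) →ₗ[ℂ] (Nat.Partition (n + 1) → ℂ) :=
    LinearMap.pi fun μ => Finsupp.lapply 0 ∘ₗ wordL φ (μ.parts.sort (· ≤ ·)) ∘ₗ comb
  have Θ_apply : ∀ f μ, Θ f μ = wordL φ (μ.parts.sort (· ≤ ·)) (comb f) 0 := fun f μ => rfl
  have hΘ : ∀ f, Θ f (Nat.Partition.indiscrete (n + 1)) = 0 := fun f => by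
    have e : (Nat.Partition.indiscrete (n + 1)).parts = {n + 1} :=
      Nat.Partition.indiscrete_parts (Nat.succ_ne_zero n)
    rw [Θ_apply, e, Multiset.sort_singleton, wordL_cons]
    have : opL φ ((n + 1 : ℕ) : ℤ) (wordL φ [] (comb f)) = 0 := by
      push_cast
      exact hker f
    rw [this, Finsupp.zero_apply]
  have hinj : ¬ Function.Injective Θ := fun h => by
    obtain ⟨f, hf⟩ := LinearMap.injective_iff_surjective.1 h fun _ => 1
    have := congrFun hf (Nat.Partition.indiscrete (n + 1))
    rw [hΘ] at this
    exact zero_ne_one this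
  rw [← LinearMap.ker_eq_bot, Submodule.eq_bot_iff] at hinj
  push Not at hinj
  obtain ⟨f, hf, hne⟩ := hinj
  refine (Submodule.ne_bot_iff _).2 ⟨comb f, ?_, ?_⟩
  · have hA : comb f ∈ supported ℂ ℂ {K | AllX K} := by
      refine (mem_supported' ℂ _).2 fun S hS => ?_
      by_contra h
      obtain ⟨ν, rfl⟩ := comb_supp f S h
      exact hS (allX_partMon ν)
    intro l hl
    rcases opW_eq_wordL φ hA l hl with h | ⟨l', hl', h⟩
    · rw [h, Finsupp.zero_apply]
    · rw [h]
      refine wordL_eq_zero φ (k := n + 1) (fun S hS => ?_) (fun μ => ?_) l' hl'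
      · obtain ⟨ν, rfl⟩ := comb_supp f S hS
        exact wt_partMon ν
      · rw [← Θ_apply, LinearMap.mem_ker.1 hf, Pi.zero_apply]
  · intro h
    refine hne (funext fun ν => ?_)
    rw [← comb_apply f ν, h]
    rfl

end

end DHV

/-! ### Generators of the enveloping algebra -/

namespace UniversalEnvelopingAlgebra

attribute [local instance] LieRing.ofAssociativeRing

/-- An enveloping algebra is generated by the image of the Lie algebra. -/
theorem adjoin_range_ι (R 𝔤 : Type*) [CommRing R] [LieRing 𝔤] [LieAlgebra R 𝔤] :
    Algebra.adjoin R (Set.range (ι R : 𝔤 → UniversalEnvelopingAlgebra R 𝔤)) = ⊤ := by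
  let S := Algebra.adjoin R (Set.range (ι R : 𝔤 → UniversalEnvelopingAlgebra R 𝔤))
  let j : 𝔤 →ₗ⁅R⁆ S :=
    { toFun := fun x => ⟨ι R x, Algebra.subset_adjoin ⟨x, rfl⟩⟩
      map_add' := fun x y => Subtype.ext (map_add _ x y)
      map_smul' := fun c x => Subtype.ext (map_smul _ c x)
      map_lie' := fun {x y} => Subtype.ext (LieHom.map_lie (ι R) x y) }
  -- Uniqueness in the universal property: the identity factors through the subalgebra `S`.
  have h : S.val.comp (lift R j) = AlgHom.id R _ := by
    refine hom_ext R (LieHom.ext fun x => ?_)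
    change S.val (lift R j (ι R x)) = ι R x
    rw [lift_ι_apply]
    rfl
  refine eq_top_iff.2 fun u _ => ?_
  have hu := DFunLike.congr_fun h u
  rw [AlgHom.id_apply] at hu
  rw [← hu]
  exact (lift R j u).2

theorem induction {R 𝔤 : Type*} [CommRing R] [LieRing 𝔤] [LieAlgebra R 𝔤]
    {p : UniversalEnvelopingAlgebra R 𝔤 → Prop} (hι : ∀ x, p (ι R x))
    (halg : ∀ c : R, p (algebraMap R _ c)) (hadd : ∀ u w, p u → p w → p (u + w))
    (hmul : ∀ u w, p u → p w → p (u * w)) (u : UniversalEnvelopingAlgebra R 𝔤) : p u := by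
  have hu : u ∈ Algebra.adjoin R (Set.range (ι R : 𝔤 → UniversalEnvelopingAlgebra R 𝔤)) := by
    rw [adjoin_range_ι]; trivial
  induction hu using Algebra.adjoin_induction with
  | mem x hx => obtain ⟨y, rfl⟩ := hx; exact hι y
  | algebraMap c => exact halg c
  | add u w _ _ hu hw => exact hadd u w hu hw
  | mul u w _ _ hu hw => exact hmul u w hu hw

end UniversalEnvelopingAlgebra

/-! ### Comparison with the quotient `U(𝔤)/I(φ)` and the criterion -/

namespace DHV

open Finsupp

attribute [local instance] LieRing.ofAssociativeRing

noncomputable section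

variable {lam : ℂ} (φ : zeroPart lam →ₗ[ℂ] ℂ)

/-- The action of the enveloping algebra on the model. -/
def rhoU : U lam →ₐ[ℂ] Module.End ℂ Model := UniversalEnvelopingAlgebra.lift ℂ (rho φ)

theorem rhoU_ι (x : DHV lam) : rhoU φ (UniversalEnvelopingAlgebra.ι ℂ x) = rho φ x :=
  UniversalEnvelopingAlgebra.lift_ι_apply ℂ (rho φ) x

theorem rhoU_mem {W : Submodule ℂ Model} (hW : ∀ x, ∀ v ∈ W, rho φ x v ∈ W) (u : U lam)
    {v : Model} (hv : v ∈ W) : rhoU φ u v ∈ W := by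
  induction u using UniversalEnvelopingAlgebra.induction generalizing v with
  | hι x => rw [rhoU_ι]; exact hW x v hv
  | halg c => rw [AlgHom.commutes]; exact W.smul_mem c hv
  | hadd u w hu hw => rw [map_add]; exact add_mem (hu hv) (hw hv)
  | hmul u w hu hw => rw [map_mul]; exact hu (hw hv)

/-- The orbit map of a vector of the model. -/
def orbit (v : Model) : U lam →ₗ[ℂ] Model :=
  LinearMap.applyₗ v ∘ₗ (rhoU φ).toLinearMap

theorem orbit_apply (v : Model) (u : U lam) : orbit φ v u = rhoU φ u v := rfl

theorem rho_mem_range_orbit (w : Model) (x : DHV lam) (v : Model)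
    (hv : v ∈ LinearMap.range (orbit φ w)) : rho φ x v ∈ LinearMap.range (orbit φ w) := by
  obtain ⟨u, rfl⟩ := hv
  exact ⟨UniversalEnvelopingAlgebra.ι ℂ x * u, by
    rw [orbit_apply, map_mul, rhoU_ι]; rfl⟩

theorem exists_rhoU_vacuum (v : Model) : ∃ u : U lam, rhoU φ u (mon 0) = v := by
  suffices h : v ∈ LinearMap.range (orbit φ (mon 0)) from h
  induction v using model_induction with
  | hadd u w hu hw => exact add_mem hu hw
  | hsmul c u hu => exact Submodule.smul_mem _ c hu
  | hmon K =>
    induction K using mon_induction with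
    | h0 => exact ⟨1, by rw [orbit_apply, map_one]; rfl⟩
    | hcons a K ha ih =>
      rw [← rho_negIndex_mon φ ha]
      exact rho_mem_range_orbit φ _ _ _ ih

theorem rho_zeroPart_vacuum (x : zeroPart lam) : rho φ x (mon 0) = φ x • mon 0 := by
  obtain ⟨x, hx⟩ := x
  unfold zeroPart at hx
  induction hx using Submodule.span_induction with
  | mem x hx =>
    rcases hx with rfl | rfl | rfl | rfl
    · exact (opL_zero_vacuum φ).trans (by rw [charVal, if_pos rfl])
    · exact opI_zero_vacuum φ
    · exact rho_CL φ _
    · exact rho_CLI φ _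
  | zero =>
    have : (⟨0, zero_mem _⟩ : zeroPart lam) = 0 := rfl
    simp only [this, map_zero, zero_smul, LinearMap.zero_apply]
  | add x y hx hy ihx ihy =>
    have : (⟨x + y, add_mem hx hy⟩ : zeroPart lam) = ⟨x, hx⟩ + ⟨y, hy⟩ := rfl
    simp only [this, map_add, LinearMap.add_apply, ihx, ihy, add_smul]
  | smul c x hx ih =>
    have : (⟨c • x, Submodule.smul_mem _ c hx⟩ : zeroPart lam) = c • ⟨x, hx⟩ := rfl
    simp only [this, map_smul, LinearMap.smul_apply, ih, smul_assoc]

theorem rhoU_vacuum_of_mem {u : U lam} (hu : u ∈ vermaIdeal lam φ) : rhoU φ u (mon 0) = 0 := by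
  unfold vermaIdeal at hu
  induction hu using Submodule.span_induction with
  | zero => rw [map_zero]; rfl
  | add u w _ _ hu hw => rw [map_add, LinearMap.add_apply, hu, hw, add_zero]
  | smul a u _ hu => rw [smul_eq_mul, map_mul, Module.End.mul_apply, hu, map_zero]
  | mem u hu =>
    rcases hu with ⟨n, hn, rfl | rfl⟩ | ⟨x, rfl⟩
    · rw [rhoU_ι]; exact opL_pos_vacuum φ hn
    · rw [rhoU_ι]; exact opI_pos_vacuum φ hn
    · rw [map_sub, rhoU_ι, AlgHom.commutes, LinearMap.sub_apply, rho_zeroPart_vacuum, sub_eq_zero]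
      rfl

/-- The highest weight vector of the Verma module. -/
def hw : Verma lam φ := Submodule.Quotient.mk 1

theorem smul_hw (u : U lam) : u • hw φ = Submodule.Quotient.mk u := by
  rw [hw, ← Submodule.Quotient.mk_smul, smul_eq_mul, mul_one]

theorem smul_hw_eq_zero {u : U lam} : u • hw φ = 0 ↔ u ∈ vermaIdeal lam φ := by
  rw [smul_hw, Submodule.Quotient.mk_eq_zero]

theorem ι_smul_hw_of_nonneg {i : DHVIndex} (hi : IsNonneg i) :
    UniversalEnvelopingAlgebra.ι ℂ (basis lam i) • hw φ = charVal φ i • hw φ := by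
  have h0 : ∀ x : zeroPart lam,
      UniversalEnvelopingAlgebra.ι ℂ (x : DHV lam) • hw φ = φ x • hw φ := fun x => by
    rw [← algebraMap_smul (U lam) (φ x), ← sub_eq_zero, ← sub_smul, smul_hw_eq_zero]
    exact Submodule.subset_span (.inr ⟨x, rfl⟩)
  have hpos : ∀ n : ℤ, 0 < n → ∀ u, (u = UniversalEnvelopingAlgebra.ι ℂ (L lam n) ∨
      u = UniversalEnvelopingAlgebra.ι ℂ (I lam n)) → u • hw φ = 0 := fun n hn u hu => by
    rw [smul_hw_eq_zero]
    exact Submodule.subset_span (.inl ⟨n, hn, hu⟩)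
  cases i with
  | CL => exact h0 ⟨CL lam, _⟩
  | CLI => exact h0 (zeroPartCLI lam)
  | L n =>
    rcases (show 0 ≤ n from hi).eq_or_lt with rfl | hn
    · rw [charVal, if_pos rfl]; exact h0 ⟨L lam 0, _⟩
    · rw [charVal, if_neg hn.ne', zero_smul]; exact hpos n hn _ (.inl rfl)
  | I n =>
    rcases (show 0 ≤ n from hi).eq_or_lt with rfl | hn
    · rw [charVal, if_pos rfl]; exact h0 (zeroPartI lam)
    · rw [charVal, if_neg hn.ne', zero_smul]; exact hpos n hn _ (.inr rfl)

/-- The Verma module is faithfully represented by the model. -/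
theorem mem_vermaIdeal_iff {u : U lam} : u ∈ vermaIdeal lam φ ↔ rhoU φ u (mon 0) = 0 := by
  refine ⟨rhoU_vacuum_of_mem φ, fun hu => ?_⟩
  let ρ : DHV lam →ₗ⁅ℂ⁆ Module.End ℂ (Verma lam φ) :=
    (AlgHom.toLieHom (Algebra.lsmul ℂ ℂ (Verma lam φ))).comp (UniversalEnvelopingAlgebra.ι ℂ)
  have hρ : ∀ x m, ρ x m = UniversalEnvelopingAlgebra.ι ℂ x • m := fun _ _ => rfl
  -- The map back from the model sends `u` applied to the vacuum to `u • hw φ`, so nothing outside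
  -- the ideal annihilates the vacuum.
  obtain ⟨f, hf0, hf⟩ := CharInd.exists_equivariant (isChar φ) ρ (hw φ) fun p => by
    rw [triBasis_apply, hρ]
    exact ι_smul_hw_of_nonneg φ p.2
  have hfU : ∀ (u : U lam) w, f (rhoU φ u w) = u • f w := fun u => by
    induction u using UniversalEnvelopingAlgebra.induction with
    | hι x => intro w; rw [rhoU_ι, ← hρ]; exact hf x w
    | halg c =>
      intro w
      rw [AlgHom.commutes, algebraMap_smul]
      exact map_smul f c w
    | hadd u u' hu hu' =>
      intro w
      rw [map_add, LinearMap.add_apply, map_add, hu, hu', add_smul]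
    | hmul u u' hu hu' =>
      intro w
      rw [map_mul, Module.End.mul_apply, hu, hu', mul_smul]
  rw [← smul_hw_eq_zero, ← hf0, ← hfU, hu, map_zero]

theorem smul_mk_eq_hw {u a : U lam} :
    u • (Submodule.Quotient.mk a : Verma lam φ) = hw φ ↔
      rhoU φ u (rhoU φ a (mon 0)) = mon 0 := by
  rw [← Submodule.Quotient.mk_smul, hw, Submodule.Quotient.eq, mem_vermaIdeal_iff, map_sub,
    map_one, smul_eq_mul, map_mul, LinearMap.sub_apply, sub_eq_zero]
  rfl

/-- A vanishing pairing gives a nonzero vector of the radical, which cannot generate the highest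
weight vector; otherwise every nonzero vector generates it, and hence everything. -/
theorem isSimpleModule_verma_iff :
    IsSimpleModule (U lam) (Verma lam φ) ↔ ∀ n, pairing φ n ≠ 0 := by
  rw [isSimpleModule_iff_toSpanSingleton_surjective]
  constructor
  · rintro ⟨-, h⟩ n hn
    obtain ⟨w, hw, hw0⟩ := (Submodule.ne_bot_iff _).1 (radical_ne_bot φ hn)
    obtain ⟨a, rfl⟩ := exists_rhoU_vacuum φ w
    have ha : (Submodule.Quotient.mk a : Verma lam φ) ≠ 0 := fun h0 =>
      hw0 ((mem_vermaIdeal_iff φ).1 ((Submodule.Quotient.mk_eq_zero _).1 h0))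
    obtain ⟨u, hu⟩ := h _ ha (DHV.hw φ)
    rw [LinearMap.toSpanSingleton_apply, smul_mk_eq_hw] at hu
    refine vacuum_notMem_radical φ ?_
    rw [← hu]
    exact rhoU_mem φ (fun x v hv => rho_mem_radical φ x hv) u hw
  · intro hc
    constructor
    · refine ⟨hw φ, 0, fun h => ?_⟩
      have h1 := (mem_vermaIdeal_iff φ).1 ((Submodule.Quotient.mk_eq_zero _).1 h)
      rw [map_one, Module.End.one_apply] at h1
      exact one_ne_zero (Finsupp.single_eq_zero.1 h1)
    · intro x hx y
      obtain ⟨a, rfl⟩ := Submodule.Quotient.mk_surjective _ x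
      obtain ⟨c, rfl⟩ := Submodule.Quotient.mk_surjective _ y
      have ha : rhoU φ a (mon 0) ≠ 0 := fun h =>
        hx ((Submodule.Quotient.mk_eq_zero _).2 ((mem_vermaIdeal_iff φ).2 h))
      obtain ⟨u, hu⟩ := vacuum_mem_of_pairing_ne_zero φ hc
        (rho_mem_range_orbit φ (rhoU φ a (mon 0))) ⟨1, by rw [orbit_apply, map_one]; rfl⟩ ha
      refine ⟨c * u, ?_⟩
      rw [LinearMap.toSpanSingleton_apply, mul_smul, (smul_mk_eq_hw φ).2 hu, smul_hw]

theorem pairing_eq_mul (n : ℕ) : pairing φ n = -(((n : ℂ) + 1) / 12) *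
    (12 * (1 + lam) * φ (zeroPartI lam)
      - (((n : ℂ) + 1) ^ 2 - 1) * φ (zeroPartCLI lam) * delta lam 1) := by
  rw [pairing, cocycle, add_neg_cancel, if_pos rfl]
  push_cast
  ring

theorem forall_pairing_ne_zero_iff : (∀ n, pairing φ n ≠ 0) ↔ ∀ k : ℤ, k ≠ 0 →
    12 * (1 + lam) * φ (zeroPartI lam)
      - ((k : ℂ) ^ 2 - 1) * φ (zeroPartCLI lam) * delta lam 1 ≠ 0 := by
  constructor
  · intro h k hk h0
    obtain ⟨n, hn⟩ : ∃ n, k.natAbs = n + 1 :=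
      Nat.exists_eq_succ_of_ne_zero (Int.natAbs_ne_zero.2 hk)
    -- Only `k²` matters, so negative `k` reduce to `|k| = n + 1`.
    have hsq : ((n : ℂ) + 1) ^ 2 = (k : ℂ) ^ 2 := by
      have : ((n : ℤ) + 1) ^ 2 = k ^ 2 := by rw [← Int.natAbs_sq k, hn]; push_cast; rfl
      exact_mod_cast this
    exact h n (by rw [pairing_eq_mul, hsq, h0, mul_zero])
  · intro h n
    have h1 := h (n + 1) (by omega)
    push_cast at h1
    rw [pairing_eq_mul]
    refine mul_ne_zero (neg_ne_zero.2 (div_ne_zero ?_ (by norm_num))) h1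
    exact_mod_cast Nat.succ_ne_zero n

end

end DHV

theorem theorem3p3 (lam : ℂ) (hlam0 : lam ≠ 0) (hlam1 : lam ≠ -1)
    (φ : DHV.zeroPart lam →ₗ[ℂ] ℂ) :
    IsSimpleModule (DHV.U lam) (DHV.Verma lam φ) ↔
      ∀ k : ℤ, k ≠ 0 →
        12 * (1 + lam) * φ (DHV.zeroPartI lam)
          - ((k : ℂ) ^ 2 - 1) * φ (DHV.zeroPartCLI lam) * DHV.delta lam 1 ≠ 0 :=
  (DHV.isSimpleModule_verma_iff φ).trans (DHV.forall_pairing_ne_zero_iff φ)
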